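/- **Conventions.** Manifolds are smooth, finite-dimensional, Hausdorff, second countable and without boundary. A *relation* $X\xleftarrow{f}Y$ with target $X$ and source $Y$ is a subset $f\subseteq X\times Y$, and $f\circ g=\{(x,z) : (x,y)\in f \text{ and } (y,z)\in g \text{ for some } y\}$. It is *smooth* if it is a closed (embedded) submanifold of $X\times Y$; its differential $Tf$ is its tangent bundle, viewed as a relation $TX\leftarrow TY$. For symplectic manifolds $(X,\omega_X)$, $(Y,\omega_Y)$, a *canonical relation* $X\leftarrow Y$ is a smooth relation that is a lagrangian submanifold of $(X,\omega_X)\times(Y,-\omega_Y)$ (the empty relation is allowed). A smooth relation $X\xleftarrow{f}Y$ is a *reduction* if $f$ and $Tf$ are both surjective (every point of the target is related to some point of the source) and single valued (every point of the source is related to at most one point of the target), and the projection $f\to Y$ is proper; it is a *coreduction* if its transpose is a reduction. A pair $X\xleftarrow{f}Y\xleftarrow{g}Z$ of smooth relations is *strongly transversal* if $f\times g$ is transversal to $X\times\Delta_Y\times Z$ in $X\times Y\times Y\times Z$ and the projection to $X\times Z$ of their intersection $f\times_Y g$ is an embedding onto a closed submanifold (which is then $f\circ g$; if $f$ and $g$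 are canonical, so is $f\circ g$). The *Wehrheim–Woodward category* has the symplectic manifolds as objects; its morphisms are the equivalence classes $[f_1,\dots,f_r]$ of finite composable sequences $X_0\xleftarrow{f_1}X_1\leftarrow\cdots\xleftarrow{f_r}X_r$ of canonical relations, composed by concatenation, under the smallest equivalence relation that allows one to insert or remove identity (diagonal) relations and to replace two successive entries forming a strongly transversal pair $(p,q)$ by the single entry $p\circ q$. **Theorem.** Let $X_0\xleftarrow{f_1}X_1\xleftarrow{f_2}\cdots\xleftarrow{f_r}X_r$ be a composable sequence of canonical relations between symplectic manifolds. Then there are a symplectic manifold $Q$ and canonical relations $X_0\xleftarrow{A}Q$ and $Q\xleftarrow{B}X_r$ such that $A$ is a reduction, $B$ is a coreduction, and $$[f_1,\dots,f_r]=[A,B]$$ in the Wehrheim–Woodward category. Consequently every morphism of this category is represented by a sequence of just two canonical relations, a reduction followed by a coreduction: $X_0\xleftarrow{A}Q\xleftarrow{B}X_r$. -/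

import Mathlib

open scoped Manifold ContDiff Topology
open CategoryTheory

universe u

namespace WehrheimWoodward

/-! ### Set-theoretic relations

A relation `f ⊆ X × Y` is regarded as a morphism to `X` (its target) from `Y` (its source). -/

section Rel

variable {α β γ : Type*}

/-- The composition `f ∘ g = {(x, z) | (x, y) ∈ f and (y, z) ∈ g for some y}`. -/
def relComp (f : Set (α × β)) (g : Set (β × γ)) : Set (α × γ) :=
  {p | ∃ y, (p.1, y) ∈ f ∧ (y, p.2) ∈ g}

/-- The transpose of a relation. -/
def relTranspose (f : Set (α × β)) : Set (β × α) := {p | (p.2, p.1) ∈ f}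

/-- Every point of the target is related to some point of the source. -/
def RelSurjective (f : Set (α × β)) : Prop := ∀ x, ∃ y, (x, y) ∈ f

/-- Single valued: every point of the source is related to at most one point of the target. -/
def RelCoinjective (f : Set (α × β)) : Prop :=
  ∀ y x x', (x, y) ∈ f → (x', y) ∈ f → x = x'

/-- The fibre product `f ×_Y g`: the intersection of `f × g` with `X × Δ_Y × Z`
in `X × Y × Y × Z`. -/
def fibreProduct (f : Set (α × β)) (g : Set (β × γ)) : Set ((α × β) × (β × γ)) :=
  {p | p.1 ∈ f ∧ p.2 ∈ g ∧ p.1.2 = p.2.1}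

/-- The subset `X × Δ_Y × Z` of `X × Y × Y × Z`. -/
def middleDiagonal (α β γ : Type*) : Set ((α × β) × (β × γ)) := {p | p.1.2 = p.2.1}

end Rel

/-! ### Submanifolds -/

section Submanifold

variable {E H : Type*} [NormedAddCommGroup E] [NormedSpace ℝ E] [TopologicalSpace H]
  (I : ModelWithCorners ℝ E H) {M : Type*} [TopologicalSpace M] [ChartedSpace H M]

/-- `S` is a smooth embedded submanifold of `M`: around each of its points there is a chart of
the maximal smooth atlas of `M` in which `S` is cut out by a linear subspace.
(Used for manifolds without boundary.) -/
def IsSubmanifold (S : Set M) : Prop :=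
  ∀ p ∈ S, ∃ e ∈ IsManifold.maximalAtlas I ∞ M, p ∈ e.source ∧
    ∃ W : Submodule ℝ E, ∀ q ∈ e.source, q ∈ S ↔ e.extend I q ∈ W

/-- The vectors tangent to `S` at `p`: the velocities at time `0` of the curves through `p`
that lie in `S` near time `0`. When `S` is a submanifold and `p ∈ S`, this is the linear subspace
`T_p S` of `T_p M`; it is empty when `p ∉ S`. -/
def tangentSet (S : Set M) (p : M) : Set (TangentSpace I p) :=
  {v | ∃ γ : ℝ → M, γ 0 = p ∧ (∀ᶠ t in 𝓝 (0 : ℝ), γ t ∈ S) ∧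
    HasMFDerivAt 𝓘(ℝ, ℝ) I γ 0
      (ContinuousLinearMap.toSpanSingleton ℝ (v : E) : ℝ →L[ℝ] E)}

/-- Two submanifolds are transversal if at each common point their tangent spaces together span
the ambient tangent space. -/
def TransversalSets (S T : Set M) : Prop :=
  ∀ p ∈ S ∩ T, ∀ v : TangentSpace I p,
    ∃ a ∈ tangentSet I S p, ∃ b ∈ tangentSet I T p, a + b = v

end Submanifold

/-! ### Symplectic manifolds -/

section Forms

variable {E : Type*} [NormedAddCommGroup E] [NormedSpace ℝ E]
  {M : Type*} [TopologicalSpace M] [ChartedSpace E M]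

/-- The local expression of a 2-form `σ` in the preferred chart around `x`: its pullback to the
model space by the inverse of the chart (meaningful on the target of the chart). -/
noncomputable def formInChart (σ : ∀ y : M, (TangentSpace 𝓘(ℝ, E) y) [⋀^Fin 2]→L[ℝ] ℝ) (x : M)
    (z : E) : E [⋀^Fin 2]→L[ℝ] ℝ :=
  (σ ((chartAt E x).symm z)).compContinuousLinearMap
    (mfderiv 𝓘(ℝ, E) 𝓘(ℝ, E) (chartAt E x).symm z)

/-- A symplectic form: a smooth, closed, nondegenerate 2-form. -/
structure IsSymplecticForm (σ : ∀ y : M, (TangentSpace 𝓘(ℝ, E) y) [⋀^Fin 2]→L[ℝ] ℝ) : Prop where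
  smooth : ∀ x, ContDiffOn ℝ ∞ (formInChart σ x) (chartAt E x).target
  closed : ∀ x, ∀ z ∈ (chartAt E x).target, extDeriv (formInChart σ x) z = 0
  nondegenerate : ∀ (x : M) (v : TangentSpace 𝓘(ℝ, E) x), (∀ w, σ x ![v, w] = 0) → v = 0

end Forms

/-- A symplectic manifold: a smooth finite-dimensional manifold (Hausdorff, second countable,
without boundary) modelled on a real vector space, with a symplectic form. -/
structure SympMan : Type (u + 1) where
  carrier : Type u
  model : Type u
  [normedAddCommGroup : NormedAddCommGroup model]
  [normedSpace : NormedSpace ℝ model]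
  [finiteDimensional : FiniteDimensional ℝ model]
  [topologicalSpace : TopologicalSpace carrier]
  [t2Space : T2Space carrier]
  [secondCountable : SecondCountableTopology carrier]
  [chartedSpace : ChartedSpace model carrier]
  [isManifold : IsManifold 𝓘(ℝ, model) ∞ carrier]
  form : ∀ x : carrier, (TangentSpace 𝓘(ℝ, model) x) [⋀^Fin 2]→L[ℝ] ℝ
  isSymplectic : IsSymplecticForm form

namespace SympMan

instance : CoeSort SympMan.{u} (Type u) := ⟨SympMan.carrier⟩

attribute [instance] normedAddCommGroup normedSpace finiteDimensional topologicalSpace t2Space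
  secondCountable chartedSpace isManifold

/-- The model with corners of a symplectic manifold (there is no boundary). -/
noncomputable abbrev I (X : SympMan.{u}) : ModelWithCorners ℝ X.model X.model := 𝓘(ℝ, X.model)

end SympMan

/-! ### Smooth and canonical relations -/

section Relations

variable {X Y Z : SympMan.{u}}

/-- A smooth relation is a closed submanifold of the product. -/
def IsSmoothRelation (f : Set (X × Y)) : Prop :=
  IsClosed f ∧ IsSubmanifold (X.I.prod Y.I) f

/-- The differential `Tf` of a relation `f`, a relation between the tangent bundles: its elements
are the tangent vectors of `f`. -/
def differential (f : Set (X × Y)) : Set (TangentBundle X.I X × TangentBundle Y.I Y) :=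
  {p | ((p.1.2, p.2.2) : X.model × Y.model) ∈ tangentSet (X.I.prod Y.I) f (p.1.1, p.2.1)}

/-- The value of the form `ω_X ⊕ (-ω_Y)` of `X × Ȳ` at the point `p` on two tangent vectors. -/
noncomputable def twistedForm (p : X × Y) (v w : X.model × Y.model) : ℝ :=
  X.form p.1 ![v.1, w.1] - Y.form p.2 ![v.2, w.2]

/-- Each tangent space of `f` is its own orthogonal with respect to `ω_X ⊕ (-ω_Y)`. -/
def IsLagrangian (f : Set (X × Y)) : Prop :=
  ∀ p ∈ f, ∀ v : X.model × Y.model, v ∈ tangentSet (X.I.prod Y.I) f p ↔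
    ∀ w : X.model × Y.model, w ∈ tangentSet (X.I.prod Y.I) f p → twistedForm p v w = 0

/-- A relation `X ← Y` is a reduction if it and its differential are surjective and single valued,
and its projection to the source `Y` is proper. -/
structure IsReduction (f : Set (X × Y)) : Prop where
  surjective : RelSurjective f
  coinjective : RelCoinjective f
  surjective_differential : RelSurjective (differential f)
  coinjective_differential : RelCoinjective (differential f)
  proper : IsProperMap (fun p : f => p.1.2)

/-- A coreduction is a relation whose transpose is a reduction. -/
def IsCoreduction (f : Set (X × Y)) : Prop := IsReduction (relTranspose f)

/-- The pair `(f, g)` of smooth relations `X ← Y ← Z` is transversal if `f × g` is transversal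
to `X × Δ_Y × Z`. -/
def IsTransversal (f : Set (X × Y)) (g : Set (Y × Z)) : Prop :=
  TransversalSets ((X.I.prod Y.I).prod (Y.I.prod Z.I)) (f ×ˢ g) (middleDiagonal X Y Z)

/-- The pair `(f, g)` is strongly transversal if it is transversal and the projection of the
manifold `f ×_Y g` to `X × Z` is an embedding onto a closed submanifold, that is, a closed
topological embedding whose differential is injective on each tangent space. -/
structure IsStronglyTransversal (f : Set (X × Y)) (g : Set (Y × Z)) : Prop where
  transversal : IsTransversal f g
  isClosedEmbedding :
    Topology.IsClosedEmbedding (fun p : fibreProduct f g => ((p.1.1.1, p.1.2.2) : X × Z))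
  immersion : ∀ p ∈ fibreProduct f g,
    Set.InjOn
      (fun v : (X.model × Y.model) × (Y.model × Z.model) => (v.1.1, v.2.2))
      (tangentSet ((X.I.prod Y.I).prod (Y.I.prod Z.I)) (fibreProduct f g) p)

end Relations

/-- A canonical relation `X ← Y`: a closed lagrangian submanifold of `X × Ȳ`. -/
structure CanRel (X Y : SympMan.{u}) : Type u where
  graph : Set (X × Y)
  smooth : IsSmoothRelation graph
  lagrangian : IsLagrangian graph

/-! ### The Wehrheim-Woodward category -/

/-- The quiver of symplectic manifolds and canonical relations. Arrows in `X ⟶ Y` are canonical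
relations with target `X` and source `Y`, so that a path `f₁, …, f_r` in this quiver is a
composable sequence `X₀ ← X₁ ← ⋯ ← X_r` written in its usual order. -/
instance : Quiver SympMan.{u} := ⟨CanRel⟩

/-- The path `⟨f⟩` with a single entry. -/
abbrev single {X Y : SympMan.{u}} (f : CanRel X Y) : Quiver.Path X Y :=
  Quiver.Hom.toPath (V := SympMan.{u}) f

/-- The elementary identifications of composable sequences of canonical relations:
an entry that is an identity (diagonal) relation may be removed, and a strongly transversal pair
of successive entries may be replaced by its composition. (The diagonal, and the set-theoretic
composition of a strongly transversal pair, are always canonical relations; `i` and `h` name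
them.) -/
inductive Elementary : HomRel (Paths SympMan.{u})
  | identity {X : SympMan.{u}} (i : CanRel X X) (hi : i.graph = Set.diagonal X) :
      Elementary (X := X) (Y := X) (single i) Quiver.Path.nil
  | comp {X Y Z : SympMan.{u}} (f : CanRel X Y) (g : CanRel Y Z) (h : CanRel X Z)
      (hfg : IsStronglyTransversal f.graph g.graph) (hh : h.graph = relComp f.graph g.graph) :
      Elementary (X := X) (Y := Z) ((single f).comp (single g)) (single h)

/-- The Wehrheim-Woodward category: the quotient of the category of composable sequences, with
concatenation as composition, by the congruence that the elementary identifications generate. -/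
abbrev WW : Type (u + 1) := Quotient Elementary.{u}

/-- A symplectic manifold as an object of the Wehrheim-Woodward category. -/
abbrev WW.of (X : SympMan.{u}) : WW.{u} := (Quotient.functor Elementary.{u}).obj X

/-- The class `[f₁, …, f_r]` of a composable sequence in the Wehrheim-Woodward category. -/
def WW.cls {X Y : SympMan.{u}} (f : Quiver.Path X Y) : WW.of X ⟶ WW.of Y :=
  (Quotient.functor Elementary.{u}).map (X := X) (Y := Y) f

end WehrheimWoodward

/-! The proof absorbs the entries one at a time and maintains a form `[A, B]` with `A : X ← Q` a
reduction and `B : Q ← Y` nonempty. Composing with `g : Y ← Z` would ordinarily require `B` and `g`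
to be transversal. This is avoided by postponing the composition. Replace `Q` by `Q × Ȳ × Y`, put
`B` and `g` side by side without composing them, and let the reduction impose that the two points of
`Y` agree: `A' = {(x, (q, y, y)) : (x, q) ∈ A}` and `B' = {((q, y', y), z) : (q, y') ∈ B, (y, z) ∈
g}`.

The identity `[A', B'] = [A, B, g]` (`cls_contract_comp_juxtapose`) holds for arbitrary `A`, `B`,
`g`. Indeed `A'` is `A` followed by the reduction of `Q × Ȳ × Y` along the diagonal, and `B'` is `B
× id` followed by `g`. That reduction followed by `B × id` is `B`. These three compositions are
strongly transversal whatever the relations are, because the diagonals supply all missing directions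
and determine the middle point. The relation `A'` is again a reduction as soon as `Y` is nonempty.
Absorbing one last identity relation turns `B` into `B × id`, which is a coreduction when `B` is
nonempty.

What remains is the empty relation, whose class absorbs everything. If `X` or `Y` is empty, it is
itself a reduction or a coreduction. Otherwise its class is a product of two nonempty relations, and
so it is covered by the first argument. To see this, adjoin to `X` and to `Y` a disjoint tangent
space, take `Q = (X ⊔ T_x X) × (Y ⊔ T_y Y)`, and let the first relation meet only `X × T_y Y` and
the second only `T_x X × Y`, using Lagrangian subspaces of the tangent spaces. Both are nonempty,
and no point of `Q` lies on both. -/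

namespace WehrheimWoodward

/-! ### Tangent vectors as velocities of curves -/

section TangentSets

variable {E H : Type*} [NormedAddCommGroup E] [NormedSpace ℝ E] [TopologicalSpace H]
  {I : ModelWithCorners ℝ E H} {M : Type*} [TopologicalSpace M] [ChartedSpace H M]
  {E' H' : Type*} [NormedAddCommGroup E'] [NormedSpace ℝ E'] [TopologicalSpace H']
  {J : ModelWithCorners ℝ E' H'} {N : Type*} [TopologicalSpace N] [ChartedSpace H' N]

theorem mem_of_mem_tangentSet {S : Set M} {p : M} {v : E} (hv : v ∈ tangentSet I S p) : p ∈ S := by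
  obtain ⟨γ, h0, hS, -⟩ := hv
  exact h0 ▸ hS.self_of_nhds

theorem zero_mem_tangentSet {S : Set M} {p : M} (hp : p ∈ S) : (0 : E) ∈ tangentSet I S p := by
  refine ⟨fun _ => p, rfl, Filter.Eventually.of_forall fun _ => hp, ?_⟩
  rw [ContinuousLinearMap.toSpanSingleton_zero]
  exact hasMFDerivAt_const p 0

/-- A differentiable map sends velocities of curves in `S` to velocities of curves in `T` if it
sends `S` to `T` locally. -/
theorem map_mem_tangentSet {S : Set M} {T : Set N} {Φ : M → N} {D : E →L[ℝ] E'} {p : M}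
    (hΦ : HasMFDerivAt I J Φ p D) (hST : ∀ᶠ q in 𝓝 p, q ∈ S → Φ q ∈ T) {v : E}
    (hv : v ∈ tangentSet I S p) : D v ∈ tangentSet J T (Φ p) := by
  obtain ⟨γ, rfl, hS, hγ⟩ := hv
  refine ⟨Φ ∘ γ, rfl, ?_, ?_⟩
  · filter_upwards [hS, hγ.continuousAt.eventually hST] with t h1 h2 using h2 h1
  · have h : HasMFDerivAt 𝓘(ℝ, ℝ) J (Φ ∘ γ) 0
        (D.comp (ContinuousLinearMap.toSpanSingleton ℝ v) : ℝ →L[ℝ] E') :=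
      HasMFDerivAt.comp (I'' := J) 0 hΦ hγ
    have hD : D.comp (ContinuousLinearMap.toSpanSingleton ℝ v) =
        ContinuousLinearMap.toSpanSingleton ℝ (D v) := by ext; simp
    rwa [hD] at h

theorem mem_tangentSet_of_eventually {S T : Set M} {p : M} (h : ∀ᶠ q in 𝓝 p, q ∈ S → q ∈ T) {v : E}
    (hv : v ∈ tangentSet I S p) : v ∈ tangentSet I T p :=
  map_mem_tangentSet (Φ := id) (D := ContinuousLinearMap.id ℝ E) (hasMFDerivAt_id p) h hv

/-- The curve is a straight line in the extended chart at `p`; without boundary the target of that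
chart is a neighbourhood, so the line stays in it for small times. -/
theorem mem_tangentSet_univ [I.Boundaryless] (p : M) (v : E) :
    v ∈ tangentSet I (Set.univ : Set M) p := by
  have hp : extChartAt I p p ∈ interior (extChartAt I p).target := by
    rw [(isOpen_extChartAt_target p).interior_eq]; exact mem_extChartAt_target p
  have hc : ContinuousAt (fun t : ℝ => extChartAt I p p + t • v) 0 := by fun_prop
  have h0 : extChartAt I p p + (0 : ℝ) • v = extChartAt I p p := by simp
  have hev : ∀ᶠ t in 𝓝 (0 : ℝ), extChartAt I p p + t • v ∈ (extChartAt I p).target :=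
    hc.eventually (by simpa only [h0] using! mem_interior_iff_mem_nhds.1 hp)
  refine ⟨fun t => (extChartAt I p).symm (extChartAt I p p + t • v), ?_, by simp, ?_, ?_⟩
  · simp
  · refine ContinuousAt.comp (g := (extChartAt I p).symm) ?_ hc
    rw [h0]
    exact continuousAt_extChartAt_symm p
  · have : HasFDerivAt (fun t : ℝ => extChartAt I p p + t • v)
        (ContinuousLinearMap.toSpanSingleton ℝ v) 0 :=
      ((ContinuousLinearMap.toSpanSingleton ℝ v).hasFDerivAt (x := (0 : ℝ))).const_add _
    refine HasFDerivAt.hasFDerivWithinAt ?_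
    simp only [extChartAt_self_apply]
    refine this.congr_of_eventuallyEq ?_
    filter_upwards [hev] with t ht
    have : extChartAt I p ((extChartAt I p).symm (extChartAt I p p + t • v)) =
      extChartAt I p p + t • v := (extChartAt I p).right_inv ht
    simpa [writtenInExtChartAt] using! this

theorem mem_tangentSet_prod {S : Set M} {T : Set N} {p : M × N} {v : E × E'} :
    v ∈ tangentSet (I.prod J) (S ×ˢ T) p ↔ v.1 ∈ tangentSet I S p.1 ∧ v.2 ∈ tangentSet J T p.2 := by
  constructor
  · intro h
    exact ⟨map_mem_tangentSet (D := ContinuousLinearMap.fst ℝ E E') (hasMFDerivAt_fst p)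
        (Filter.Eventually.of_forall fun q hq => hq.1) h,
      map_mem_tangentSet (D := ContinuousLinearMap.snd ℝ E E') (hasMFDerivAt_snd p)
        (Filter.Eventually.of_forall fun q hq => hq.2) h⟩
  · rintro ⟨⟨γ, h0, hS, hγ⟩, ⟨δ, k0, hT, hδ⟩⟩
    refine ⟨fun t => (γ t, δ t), by ext <;> simp [h0, k0],
      by filter_upwards [hS, hT] with t a b using ⟨a, b⟩, ?_⟩
    have := hγ.prodMk hδ
    convert! this using 1

theorem mem_tangentSet_preimage {S : Set N} (Φ : M ≃ N) (D : E ≃L[ℝ] E')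
    (hΦ : ∀ p, HasMFDerivAt I J Φ p (D : E →L[ℝ] E'))
    (hΨ : ∀ q, HasMFDerivAt J I Φ.symm q (D.symm : E' →L[ℝ] E)) {p : M} {v : E} :
    v ∈ tangentSet I (Φ ⁻¹' S) p ↔ D v ∈ tangentSet J S (Φ p) := by
  constructor
  · exact fun h => map_mem_tangentSet (hΦ p) (Filter.Eventually.of_forall fun q hq => hq) h
  · intro h
    have := map_mem_tangentSet (T := Φ ⁻¹' S) (hΨ (Φ p))
      (Filter.Eventually.of_forall fun q hq => by simpa using hq) h
    rw [Φ.symm_apply_apply] at this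
    simpa using this

/-- The tangent vectors of a linear subspace, where it is read off by a differentiable map with
values in a vector space. -/
theorem mem_submodule_of_mem_tangentSet [FiniteDimensional ℝ E'] {S : Set M} (W : Submodule ℝ E')
    {Φ : M → E'} {D : E →L[ℝ] E'} {p : M} (hΦ : HasMFDerivAt I 𝓘(ℝ, E') Φ p D)
    (hS : ∀ᶠ q in 𝓝 p, q ∈ S → Φ q ∈ W) {v : E} (hv : v ∈ tangentSet I S p) : D v ∈ W := by
  obtain ⟨γ, h0, hT, hγ⟩ := map_mem_tangentSet (T := (W : Set E')) hΦ hS hv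
  have hγ' : HasFDerivAt γ (ContinuousLinearMap.toSpanSingleton ℝ (D v)) 0 :=
    hasMFDerivAt_iff_hasFDerivAt.1 hγ
  have hd : HasDerivAt γ (D v) 0 := by
    simpa using hγ'.hasDerivAt
  have hc : IsClosed (W : Set E') := W.closed_of_finiteDimensional
  -- The difference quotients of the curve lie in `W`, which is closed, hence so does their limit.
  refine hc.mem_of_tendsto (hasDerivAt_iff_tendsto_slope.1 hd) ?_
  filter_upwards [hT.filter_mono nhdsWithin_le_nhds] with t ht
  rw [slope_def_module]
  exact W.smul_mem _ (W.sub_mem ht hT.self_of_nhds)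

theorem mem_tangentSet_submodule [FiniteDimensional ℝ E] {W : Submodule ℝ E} {p v : E} (hp : p ∈ W) :
    v ∈ tangentSet 𝓘(ℝ, E) (W : Set E) p ↔ v ∈ W := by
  constructor
  · exact fun h => mem_submodule_of_mem_tangentSet W (D := ContinuousLinearMap.id ℝ E)
      (hasMFDerivAt_id p) (Filter.Eventually.of_forall fun q hq => hq) h
  · intro h
    refine ⟨fun t => p + t • v, by simp, Filter.Eventually.of_forall fun t =>
      W.add_mem hp (W.smul_mem _ h), ?_⟩
    exact hasMFDerivAt_iff_hasFDerivAt.2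
      (((ContinuousLinearMap.toSpanSingleton ℝ v).hasFDerivAt (x := (0 : ℝ))).const_add _)

end TangentSets

/-! ### Submanifolds through straightening charts -/

section Straightening

variable {E H : Type*} [NormedAddCommGroup E] [NormedSpace ℝ E] [TopologicalSpace H]
  {I : ModelWithCorners ℝ E H} {M : Type*} [TopologicalSpace M] [ChartedSpace H M]
  {E' H' : Type*} [NormedAddCommGroup E'] [NormedSpace ℝ E'] [TopologicalSpace H']
  {J : ModelWithCorners ℝ E' H'} {N : Type*} [TopologicalSpace N] [ChartedSpace H' N]

/-- A vector-space valued smooth chart around `p` whose target model is `F` and which straightens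
`S` to a linear subspace. -/
def Straightens (I : ModelWithCorners ℝ E H) {F : Type*} [NormedAddCommGroup F] [NormedSpace ℝ F]
    (S : Set M) (p : M) (ψ : OpenPartialHomeomorph M F) : Prop :=
  p ∈ ψ.source ∧ ContMDiffOn I 𝓘(ℝ, F) ∞ ψ ψ.source ∧ ContMDiffOn 𝓘(ℝ, F) I ∞ ψ.symm ψ.target ∧
    ∃ W : Submodule ℝ F, ∀ q ∈ ψ.source, q ∈ S ↔ ψ q ∈ W

theorem IsSubmanifold.exists_straightens [I.Boundaryless] [IsManifold I ∞ M] {S : Set M}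
    (hS : IsSubmanifold I S) {p : M} (hp : p ∈ S) :
    ∃ ψ : OpenPartialHomeomorph M E, Straightens I S p ψ := by
  obtain ⟨e, he, hpe, W, hW⟩ := hS p hp
  refine ⟨e.trans I.toHomeomorph.toOpenPartialHomeomorph, by simpa using hpe, ?_, ?_, W, ?_⟩
  · have := I.contMDiff (n := ∞).comp_contMDiffOn (contMDiffOn_of_mem_maximalAtlas he)
    simpa using! this
  · have h1 : ContMDiff 𝓘(ℝ, E) I ∞ I.symm := by
      have := I.contMDiffOn_symm (n := ∞)
      rwa [ModelWithCorners.range_eq_univ, contMDiffOn_univ] at this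
    have := (contMDiffOn_symm_of_mem_maximalAtlas he).comp (h1.contMDiffOn
      (s := I.symm ⁻¹' e.target)) (fun _ h => h)
    simpa using! this
  · intro q hq
    exact hW q (by simpa using hq)

/-- Composing with `L` and the inverse of the model turns the straightening map into a member of the
maximal atlas. Allowing another model space `F` makes it possible to pull submanifolds back along a
diffeomorphism between manifolds with different model spaces. -/
theorem isSubmanifold_of_straightens [I.Boundaryless] [IsManifold I ∞ M] {S : Set M}
    {F : Type*} [NormedAddCommGroup F] [NormedSpace ℝ F] (L : F ≃L[ℝ] E)
    (h : ∀ p ∈ S, ∃ ψ : OpenPartialHomeomorph M F, Straightens I S p ψ) : IsSubmanifold I S := by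
  intro p hp
  obtain ⟨ψ, hpψ, h1, h2, W, hW⟩ := h p hp
  have hs : ContMDiff 𝓘(ℝ, E) I ∞ I.symm := by
    have := I.contMDiffOn_symm (n := ∞)
    rwa [ModelWithCorners.range_eq_univ, contMDiffOn_univ] at this
  have hL : ContMDiff 𝓘(ℝ, F) 𝓘(ℝ, E) ∞ L := L.contDiff.contMDiff
  have hL' : ContMDiff 𝓘(ℝ, E) 𝓘(ℝ, F) ∞ L.symm := L.symm.contDiff.contMDiff
  refine ⟨ψ.trans (L.toHomeomorph.toOpenPartialHomeomorph.trans
    I.toHomeomorph.symm.toOpenPartialHomeomorph), ?_, by simpa using hpψ, W.map (L : F →ₗ[ℝ] E), ?_⟩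
  · apply OpenPartialHomeomorph.mem_maximalAtlas_of_contMDiffOn
    · have := (hs.comp hL).comp_contMDiffOn h1
      simpa using! this
    · have := h2.comp ((hL'.comp (I.contMDiff (n := ∞))).contMDiffOn
        (s := (L.symm ∘ I) ⁻¹' ψ.target)) (fun _ h => h)
      simpa using! this
  · intro q hq
    have hq' : q ∈ ψ.source := by simpa using hq
    rw [hW q hq']
    have : (ψ.trans (L.toHomeomorph.toOpenPartialHomeomorph.trans
      I.toHomeomorph.symm.toOpenPartialHomeomorph)).extend I q = L (ψ q) := by
      have : I (I.symm (L (ψ q))) = L (ψ q) :=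
        I.right_inv (by rw [ModelWithCorners.range_eq_univ]; trivial)
      simpa using! this
    rw [this]
    constructor
    · exact fun h => ⟨_, h, rfl⟩
    · rintro ⟨x, hx, hxe⟩
      rwa [← L.injective hxe]

theorem IsSubmanifold.prod [I.Boundaryless] [IsManifold I ∞ M] [J.Boundaryless]
    [IsManifold J ∞ N] {S : Set M} {T : Set N}
    (hS : IsSubmanifold I S) (hT : IsSubmanifold J T) : IsSubmanifold (I.prod J) (S ×ˢ T) := by
  rintro ⟨p, q⟩ ⟨hp, hq⟩
  obtain ⟨e, he, hpe, W, hW⟩ := hS p hp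
  obtain ⟨e', he', hqe, W', hW'⟩ := hT q hq
  refine ⟨e.prod e', IsManifold.mem_maximalAtlas_prod he he', ⟨hpe, hqe⟩, W.prod W', ?_⟩
  rintro ⟨x, y⟩ ⟨hx, hy⟩
  exact and_congr (hW x hx) (hW' y hy)

theorem IsSubmanifold.preimage [I.Boundaryless] [IsManifold I ∞ M] [J.Boundaryless]
    [IsManifold J ∞ N] {S : Set N} (hS : IsSubmanifold J S) (Φ : M ≃ N) (L : E' ≃L[ℝ] E)
    (h1 : ContMDiff I J ∞ Φ) (h2 : ContMDiff J I ∞ Φ.symm) : IsSubmanifold I (Φ ⁻¹' S) := by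
  refine isSubmanifold_of_straightens L fun p hp => ?_
  obtain ⟨ψ, hψ, k1, k2, W, hW⟩ := hS.exists_straightens hp
  let Ψ : M ≃ₜ N := ⟨Φ, h1.continuous, h2.continuous⟩
  refine ⟨Ψ.toOpenPartialHomeomorph.trans ψ, by simpa using! hψ, ?_, ?_, W, ?_⟩
  · have := k1.comp (h1.contMDiffOn (s := Φ ⁻¹' ψ.source)) (fun _ h => h)
    simpa using! this
  · have := h2.comp_contMDiffOn k2
    simpa using! this
  · intro q hq
    exact hW (Φ q) (by simpa using! hq)

end Straightening

/-! ### Two-forms in charts -/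

section LocalForms

variable {E : Type*} [NormedAddCommGroup E] [NormedSpace ℝ E]
  {M : Type*} [TopologicalSpace M] [ChartedSpace E M]

theorem formInChart_eq {σ : ∀ y : M, (TangentSpace 𝓘(ℝ, E) y) [⋀^Fin 2]→L[ℝ] ℝ} {x : M} {z : E}
    {y : M} (hy : (chartAt E x).symm z = y) {D : E →L[ℝ] E}
    (hD : HasMFDerivAt 𝓘(ℝ, E) 𝓘(ℝ, E) (chartAt E x).symm z D) :
    formInChart σ x z = (σ y : E [⋀^Fin 2]→L[ℝ] ℝ).compContinuousLinearMap D := by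
  subst hy
  rw [formInChart, hD.mfderiv]

theorem hasMFDerivAt_chartAt_symm [IsManifold 𝓘(ℝ, E) ∞ M] (x : M) {z : E}
    (hz : z ∈ (chartAt E x).target) :
    HasMFDerivAt 𝓘(ℝ, E) 𝓘(ℝ, E) (chartAt E x).symm z
      (mfderiv 𝓘(ℝ, E) 𝓘(ℝ, E) (chartAt E x).symm z) :=
  ((contMDiffOn_chart_symm (I := 𝓘(ℝ, E)) (n := ∞) (x := x)).contMDiffAt
    ((chartAt E x).open_target.mem_nhds hz)).mdifferentiableAt (by simp) |>.hasMFDerivAt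

variable {F : Type*} [NormedAddCommGroup F] [NormedSpace ℝ F]

theorem extDeriv_comp_continuousLinearMap {η : F → F [⋀^Fin 2]→L[ℝ] ℝ} (L : E →L[ℝ] F) {z : E}
    (hη : DifferentiableAt ℝ η (L z)) :
    extDeriv (fun z => (η (L z)).compContinuousLinearMap L) z =
      (extDeriv η (L z)).compContinuousLinearMap L := by
  have := extDeriv_pullback (r := ∞) hη L.contDiff.contDiffAt
    (by simpa using (WithTop.coe_le_coe.2 le_top : (2 : ℕ∞ω) ≤ ∞))
  simpa using this

theorem differentiableAt_comp_continuousLinearMap {η : F → F [⋀^Fin 2]→L[ℝ] ℝ} (L : E →L[ℝ] F)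
    {z : E} (hη : DifferentiableAt ℝ η (L z)) :
    DifferentiableAt ℝ (fun z => (η (L z)).compContinuousLinearMap L) z :=
  (ContinuousAlternatingMap.compContinuousLinearMapCLM (𝕜 := ℝ) (F := ℝ) (ι := Fin 2) L
    ).differentiableAt.comp z
    (hη.comp z L.differentiableAt)

theorem contDiffOn_comp_continuousLinearMap {η : F → F [⋀^Fin 2]→L[ℝ] ℝ} (L : E →L[ℝ] F)
    {s : Set F} (hη : ContDiffOn ℝ ∞ η s) :
    ContDiffOn ℝ ∞ (fun z => (η (L z)).compContinuousLinearMap L) (L ⁻¹' s) :=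
  (ContinuousAlternatingMap.compContinuousLinearMapCLM (𝕜 := ℝ) (F := ℝ) (ι := Fin 2) L
    ).contDiff.comp_contDiffOn
    (hη.comp L.contDiff.contDiffOn fun _ h => h)

theorem IsSymplecticForm.differentiableAt
    {σ : ∀ y : M, (TangentSpace 𝓘(ℝ, E) y) [⋀^Fin 2]→L[ℝ] ℝ} (hσ : IsSymplecticForm σ) (x : M)
    {z : E} (hz : z ∈ (chartAt E x).target) : DifferentiableAt ℝ (formInChart σ x) z :=
  ((hσ.smooth x).contDiffAt ((chartAt E x).open_target.mem_nhds hz)).differentiableAt (by simp)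

theorem IsSymplecticForm.neg {σ : ∀ y : M, (TangentSpace 𝓘(ℝ, E) y) [⋀^Fin 2]→L[ℝ] ℝ}
    (hσ : IsSymplecticForm σ) : IsSymplecticForm fun y => -σ y := by
  -- The opposite form is written as a scalar multiple so that `extDeriv_smul` applies.
  have h (x : M) : formInChart (fun y => -σ y) x = fun z => (-1 : ℝ) • formInChart σ x z := by
    ext z v
    simp only [formInChart, ContinuousAlternatingMap.smul_apply, neg_smul, one_smul]
    rfl
  refine ⟨fun x => ?_, fun x z hz => ?_, fun x v hv => hσ.nondegenerate x v fun w => ?_⟩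
  · rw [h]
    exact (hσ.smooth x).const_smul _
  · have : extDeriv ((-1 : ℝ) • formInChart σ x) z = 0 := by
      rw [extDeriv_smul (-1) (formInChart σ x), hσ.closed x z hz, smul_zero]
    rw [h]
    exact this
  · have := hv w
    simpa using this

end LocalForms


/-! ### Products, opposites, disjoint unions with a tangent space, Lagrangian subspaces -/

namespace SympMan

noncomputable instance prodChartedSpace (X Y : SympMan.{u}) :
    ChartedSpace (X.model × Y.model) (X × Y) :=
  _root_.prodChartedSpace X.model X Y.model Y

theorem prod_isManifold (X Y : SympMan.{u}) :
    IsManifold 𝓘(ℝ, X.model × Y.model) ∞ (X × Y) := by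
  rw [modelWithCornersSelf_prod]
  exact IsManifold.prod (I := X.I) (I' := Y.I) X Y

/-- The symplectic form at a point, as a form on the model space. -/
noncomputable def formAt (X : SympMan.{u}) (x : X) : X.model [⋀^Fin 2]→L[ℝ] ℝ := X.form x

/-- The form `ω_X ⊕ ω_Y` at a point of `X × Y`. -/
noncomputable def prodForm (X Y : SympMan.{u}) (p : X × Y) :
    (X.model × Y.model) [⋀^Fin 2]→L[ℝ] ℝ :=
  (X.formAt p.1).compContinuousLinearMap (.fst ℝ X.model Y.model) +
    (Y.formAt p.2).compContinuousLinearMap (.snd ℝ X.model Y.model)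

/-- The symplectic form at a point, as a function of two vectors of the model space. -/
noncomputable def om (X : SympMan.{u}) (x : X) (v w : X.model) : ℝ := X.formAt x ![v, w]

theorem om_zero_left (X : SympMan.{u}) (x : X) (w : X.model) : X.om x 0 w = 0 :=
  (X.formAt x).map_coord_zero (m := ![0, w]) 0 rfl

theorem om_zero_right (X : SympMan.{u}) (x : X) (w : X.model) : X.om x w 0 = 0 :=
  (X.formAt x).map_coord_zero (m := ![w, 0]) 1 rfl


theorem om_self (X : SympMan.{u}) (x : X) (v : X.model) : X.om x v v = 0 :=
  (X.formAt x).map_eq_zero_of_eq ![v, v] (i := 0) (j := 1) rfl (by simp)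

theorem om_add_left (X : SympMan.{u}) (x : X) (v v' w : X.model) :
    X.om x (v + v') w = X.om x v w + X.om x v' w := by
  have := (X.formAt x).map_update_add ![0, w] 0 v v'
  have h (a : X.model) : Function.update ![0, w] 0 a = ![a, w] := by ext i; fin_cases i <;> simp
  rwa [h, h, h] at this

theorem om_smul_left (X : SympMan.{u}) (x : X) (c : ℝ) (v w : X.model) :
    X.om x (c • v) w = c * X.om x v w := by
  have := (X.formAt x).map_update_smul ![0, w] 0 c v
  have h (a : X.model) : Function.update ![0, w] 0 a = ![a, w] := by ext i; fin_cases i <;> simp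
  rwa [h, h] at this

theorem om_swap (X : SympMan.{u}) (x : X) (v w : X.model) : X.om x w v = -X.om x v w := by
  have := (X.formAt x).map_swap ![v, w] (i := 0) (j := 1) (by simp)
  have h : ![v, w] ∘ Equiv.swap (0 : Fin 2) 1 = ![w, v] := by
    ext i; fin_cases i <;> simp
  rwa [h] at this

theorem om_nondegenerate (X : SympMan.{u}) {x : X} {v : X.model} (h : ∀ w, X.om x v w = 0) :
    v = 0 := X.isSymplectic.nondegenerate x v h

theorem prodForm_apply (X Y : SympMan.{u}) (p : X × Y) (v w : X.model × Y.model) :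
    prodForm X Y p ![v, w] = X.om p.1 v.1 w.1 + Y.om p.2 v.2 w.2 := by
  have h1 : (ContinuousLinearMap.fst ℝ X.model Y.model) ∘ ![v, w] = ![v.1, w.1] := by
    ext i; fin_cases i <;> rfl
  have h2 : (ContinuousLinearMap.snd ℝ X.model Y.model) ∘ ![v, w] = ![v.2, w.2] := by
    ext i; fin_cases i <;> rfl
  rw [prodForm, ContinuousAlternatingMap.add_apply,
    ContinuousAlternatingMap.compContinuousLinearMap_apply,
    ContinuousAlternatingMap.compContinuousLinearMap_apply, h1, h2]
  rfl

/-- The sum of the pullbacks of two forms to a product of vector spaces. -/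
noncomputable def sumPullback {E F : Type*} [NormedAddCommGroup E] [NormedSpace ℝ E]
    [NormedAddCommGroup F] [NormedSpace ℝ F] (η : E → E [⋀^Fin 2]→L[ℝ] ℝ)
    (θ : F → F [⋀^Fin 2]→L[ℝ] ℝ) (z : E × F) : (E × F) [⋀^Fin 2]→L[ℝ] ℝ :=
  (η (ContinuousLinearMap.fst ℝ E F z)).compContinuousLinearMap (.fst ℝ E F) +
    (θ (ContinuousLinearMap.snd ℝ E F z)).compContinuousLinearMap (.snd ℝ E F)

theorem contDiffOn_sumPullback {E F : Type*} [NormedAddCommGroup E] [NormedSpace ℝ E]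
    [NormedAddCommGroup F] [NormedSpace ℝ F] {η : E → E [⋀^Fin 2]→L[ℝ] ℝ}
    {θ : F → F [⋀^Fin 2]→L[ℝ] ℝ} {s : Set E} {t : Set F} (hη : ContDiffOn ℝ ∞ η s)
    (hθ : ContDiffOn ℝ ∞ θ t) : ContDiffOn ℝ ∞ (sumPullback η θ) (s ×ˢ t) :=
  ((contDiffOn_comp_continuousLinearMap (.fst ℝ E F) hη).mono fun _ hz => hz.1).add
    ((contDiffOn_comp_continuousLinearMap (.snd ℝ E F) hθ).mono fun _ hz => hz.2)

theorem extDeriv_sumPullback_eq_zero {E F : Type*} [NormedAddCommGroup E] [NormedSpace ℝ E]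
    [NormedAddCommGroup F] [NormedSpace ℝ F] {η : E → E [⋀^Fin 2]→L[ℝ] ℝ}
    {θ : F → F [⋀^Fin 2]→L[ℝ] ℝ} {z : E × F} (hη : DifferentiableAt ℝ η z.1)
    (hθ : DifferentiableAt ℝ θ z.2) (h1 : extDeriv η z.1 = 0) (h2 : extDeriv θ z.2 = 0) :
    extDeriv (sumPullback η θ) z = 0 := by
  have e1 := extDeriv_comp_continuousLinearMap (.fst ℝ E F) hη
  have e2 := extDeriv_comp_continuousLinearMap (.snd ℝ E F) hθ
  rw [ContinuousLinearMap.coe_fst', h1] at e1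
  rw [ContinuousLinearMap.coe_snd', h2] at e2
  have := extDeriv_fun_add (differentiableAt_comp_continuousLinearMap (.fst ℝ E F) hη)
    (differentiableAt_comp_continuousLinearMap (.snd ℝ E F) hθ)
  refine this.trans ?_
  refine (congrArg₂ (· + ·) e1 e2).trans ?_
  ext
  simp

theorem formInChart_prodForm (X Y : SympMan.{u}) (p : X × Y) {z : X.model × Y.model}
    (hz : z ∈ (chartAt X.model p.1).target ×ˢ (chartAt Y.model p.2).target) :
    formInChart (M := X × Y) (prodForm X Y) p z =
      sumPullback (formInChart X.form p.1) (formInChart Y.form p.2) z := by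
  have hD := (hasMFDerivAt_chartAt_symm p.1 hz.1).prodMap (hasMFDerivAt_chartAt_symm p.2 hz.2)
  exact (formInChart_eq (M := X × Y) (x := p) (z := z) (σ := prodForm X Y) rfl hD).trans rfl

theorem isSymplecticForm_prodForm (X Y : SympMan.{u}) :
    IsSymplecticForm (M := X × Y) (prodForm X Y) where
  smooth p :=
    (contDiffOn_sumPullback (X.isSymplectic.smooth p.1) (Y.isSymplectic.smooth p.2)).congr
      fun _ hz => formInChart_prodForm X Y p hz
  closed p z hz := by
    have hev : formInChart (M := X × Y) (prodForm X Y) p =ᶠ[𝓝 z]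
        sumPullback (formInChart X.form p.1) (formInChart Y.form p.2) :=
      Filter.eventually_of_mem
        (((chartAt X.model p.1).open_target.prod (chartAt Y.model p.2).open_target).mem_nhds hz)
        fun z hz => formInChart_prodForm X Y p hz
    exact hev.extDeriv_eq.trans (extDeriv_sumPullback_eq_zero
      (X.isSymplectic.differentiableAt p.1 hz.1) (Y.isSymplectic.differentiableAt p.2 hz.2)
      (X.isSymplectic.closed p.1 _ hz.1) (Y.isSymplectic.closed p.2 _ hz.2))
  nondegenerate p v hv := by
    refine Prod.ext (X.isSymplectic.nondegenerate p.1 v.1 fun w => ?_)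
      (Y.isSymplectic.nondegenerate p.2 v.2 fun w => ?_)
    · have h1 := (prodForm_apply X Y p v (w, 0)).symm.trans (hv (w, 0))
      exact (add_eq_left.2 (om_zero_right Y p.2 v.2)).symm.trans h1
    · have h1 := (prodForm_apply X Y p v (0, w)).symm.trans (hv (0, w))
      exact (add_eq_right.2 (om_zero_right X p.1 v.1)).symm.trans h1

/-- The product of symplectic manifolds. -/
noncomputable def prod (X Y : SympMan.{u}) : SympMan.{u} where
  carrier := X × Y
  model := X.model × Y.model
  chartedSpace := prodChartedSpace X Y
  isManifold := prod_isManifold X Y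
  form := prodForm X Y
  isSymplectic := isSymplecticForm_prodForm X Y

/-- The symplectic manifold with the opposite form. -/
noncomputable def neg (X : SympMan.{u}) : SympMan.{u} where
  carrier := X
  model := X.model
  form := fun x => -X.form x
  isSymplectic := X.isSymplectic.neg

theorem prod_om (X Y : SympMan.{u}) (p : X.prod Y) (v w : (X.prod Y).model) :
    (X.prod Y).om p v w = X.om p.1 v.1 w.1 + Y.om p.2 v.2 w.2 := prodForm_apply X Y p v w

theorem neg_om (X : SympMan.{u}) (x : X) (v w : X.model) : X.neg.om x v w = -X.om x v w := rfl

/-- The form on the disjoint union of `X` and its model space which is `ω_X` on the first component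
and the constant form `ω_X(x₀)` on the second one. -/
noncomputable def sumForm (X : SympMan.{u}) (x₀ : X) : X ⊕ X.model → X.model [⋀^Fin 2]→L[ℝ] ℝ
  | .inl x => X.formAt x
  | .inr _ => X.formAt x₀

theorem sum_chartAt_inl_symm (X : SympMan.{u}) (x : X) :
    ⇑(chartAt X.model (Sum.inl x : X ⊕ X.model)).symm = Sum.inl ∘ (chartAt X.model x).symm ∧
    (chartAt X.model (Sum.inl x : X ⊕ X.model)).target = (chartAt X.model x).target := by
  rw [ChartedSpace.sum_chartAt_inl]
  exact ⟨rfl, rfl⟩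

theorem sum_chartAt_inr_symm (X : SympMan.{u}) (x : X.model) :
    ⇑(chartAt X.model (Sum.inr x : X ⊕ X.model)).symm = Sum.inr := by
  rw [ChartedSpace.sum_chartAt_inr]
  rfl

theorem formInChart_sumForm_inl (X : SympMan.{u}) (x₀ x : X) {z : X.model}
    (hz : z ∈ (chartAt X.model x).target) :
    formInChart (M := X ⊕ X.model) (sumForm X x₀) (.inl x) z = formInChart X.form x z := by
  have hD := hasMFDerivAt_chartAt_symm x hz
  have hD' := HasMFDerivAt.comp (I'' := X.I) z
    (hasMFDerivAt_inl (I := X.I) (M' := X.model) (q := (chartAt X.model x).symm z)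
      (p := .inl x₀)) hD
  rw [← (sum_chartAt_inl_symm X x).1] at hD'
  rw [formInChart_eq (M := X ⊕ X.model) (x := .inl x) (z := z) (σ := sumForm X x₀)
    (congrFun (sum_chartAt_inl_symm X x).1 z) hD', formInChart_eq rfl hD]
  rfl

theorem formInChart_sumForm_inr (X : SympMan.{u}) (x₀ : X) (x z : X.model) :
    formInChart (M := X ⊕ X.model) (sumForm X x₀) (.inr x) z = X.formAt x₀ := by
  have hD := hasMFDerivAt_inr (I := X.I) (M := X) (M' := X.model) (q' := z) (p := .inl x₀)
  rw [← sum_chartAt_inr_symm X x] at hD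
  rw [formInChart_eq (M := X ⊕ X.model) (x := .inr x) (z := z) (σ := sumForm X x₀)
    (congrFun (sum_chartAt_inr_symm X x) z) hD]
  rfl

/-- On the vector space component the form is constant in the chart, hence smooth and closed;
elsewhere everything is inherited from `X`. -/
theorem isSymplecticForm_sumForm (X : SympMan.{u}) (x₀ : X) :
    IsSymplecticForm (M := X ⊕ X.model) (sumForm X x₀) where
  smooth p := by
    rcases p with x | x
    · rw [(sum_chartAt_inl_symm X x).2]
      exact (X.isSymplectic.smooth x).congr fun z hz => formInChart_sumForm_inl X x₀ x hz
    · exact contDiffOn_const.congr fun z hz => formInChart_sumForm_inr X x₀ x z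
  closed p z hz := by
    rcases p with x | x
    · rw [(sum_chartAt_inl_symm X x).2] at hz
      have hev : formInChart (M := X ⊕ X.model) (sumForm X x₀) (.inl x) =ᶠ[𝓝 z]
          formInChart X.form x :=
        Filter.eventually_of_mem ((chartAt X.model x).open_target.mem_nhds hz)
          fun z hz => formInChart_sumForm_inl X x₀ x hz
      rw [hev.extDeriv_eq, X.isSymplectic.closed x z hz]
    · have hev : formInChart (M := X ⊕ X.model) (sumForm X x₀) (.inr x) = fun _ => X.formAt x₀ :=
        funext fun z => formInChart_sumForm_inr X x₀ x z
      rw [hev]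
      ext v
      rw [extDeriv_apply (differentiableAt_const _)]
      simp
  nondegenerate p v hv := by
    rcases p with x | x
    · exact X.isSymplectic.nondegenerate x v hv
    · exact X.isSymplectic.nondegenerate x₀ v hv

/-- The disjoint union of `X` with its tangent space at `x₀`, regarded as a symplectic vector
space. -/
noncomputable def sumTangent (X : SympMan.{u}) (x₀ : X) : SympMan.{u} where
  carrier := X ⊕ X.model
  model := X.model
  secondCountable := inferInstance
  form := sumForm X x₀
  isSymplectic := isSymplecticForm_sumForm X x₀

/-- The inclusion of `X` into `X.sumTangent x₀`. -/
def inl (X : SympMan.{u}) (x₀ : X) (x : X) : X.sumTangent x₀ := (Sum.inl x : X ⊕ X.model)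

/-- The inclusion of the tangent space into `X.sumTangent x₀`. -/
def inr (X : SympMan.{u}) (x₀ : X) (x : X.model) : X.sumTangent x₀ := (Sum.inr x : X ⊕ X.model)

/-- A symplectic vector space contains a Lagrangian subspace. -/
theorem exists_lagrangian_submodule (X : SympMan.{u}) (x : X) :
    ∃ W : Submodule ℝ X.model, ∀ v, v ∈ W ↔ ∀ w ∈ W, X.om x v w = 0 := by
  obtain ⟨W, hW, hmax⟩ : ∃ W : Submodule ℝ X.model, (∀ v ∈ W, ∀ w ∈ W, X.om x v w = 0) ∧
      ∀ W' : Submodule ℝ X.model, (∀ v ∈ W', ∀ w ∈ W', X.om x v w = 0) → W ≤ W' → W' ≤ W := by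
    have hne : {W : Submodule ℝ X.model | ∀ v ∈ W, ∀ w ∈ W, X.om x v w = 0}.Nonempty :=
      ⟨⊥, by rintro v hv w -; rw [(Submodule.mem_bot ℝ).1 hv, om_zero_left]⟩
    -- Finite dimension provides a maximal isotropic subspace.
    obtain ⟨W, hW, hmax⟩ := wellFounded_gt.has_min _ hne
    exact ⟨W, hW, fun W' h h' => (eq_of_le_of_not_lt h' (hmax W' h)).ge⟩
  refine ⟨W, fun v => ⟨hW v, fun hv => ?_⟩⟩
  -- A vector orthogonal to `W` is also orthogonal to itself, so adjoining it keeps the subspace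
  -- isotropic; by maximality it already lies in `W`.
  refine hmax (W ⊔ Submodule.span ℝ {v}) ?_ le_sup_left
    ((le_sup_right : _ ≤ W ⊔ Submodule.span ℝ {v}) (Submodule.mem_span_singleton_self v))
  have hv' : ∀ w ∈ W, X.om x w v = 0 := fun w hw => by rw [om_swap, hv w hw, neg_zero]
  have key : ∀ w ∈ W ⊔ Submodule.span ℝ {v}, ∀ a ∈ W, X.om x w a = 0 := by
    intro w hw a ha
    obtain ⟨b, hb, c, rfl⟩ : ∃ b ∈ W, ∃ c : ℝ, b + c • v = w := by
      obtain ⟨b, hb, z, hz, rfl⟩ := Submodule.mem_sup.1 hw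
      obtain ⟨c, rfl⟩ := Submodule.mem_span_singleton.1 hz
      exact ⟨b, hb, c, rfl⟩
    rw [om_add_left, om_smul_left, hW b hb a ha, hv a ha, mul_zero, add_zero]
  intro w hw a ha
  obtain ⟨b, hb, z, hz, rfl⟩ := Submodule.mem_sup.1 hw
  obtain ⟨c, rfl⟩ := Submodule.mem_span_singleton.1 hz
  obtain ⟨b', hb', z', hz', rfl⟩ := Submodule.mem_sup.1 ha
  obtain ⟨c', rfl⟩ := Submodule.mem_span_singleton.1 hz'
  have h1 : X.om x b (b' + c' • v) = 0 := by
    rw [om_swap, om_add_left, om_smul_left, hW b' hb' b hb, hv b hb]; simp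
  have h2 : X.om x v (b' + c' • v) = 0 := by
    rw [om_swap, om_add_left, om_smul_left, hv' b' hb', om_self]; simp
  rw [om_add_left, om_smul_left, h1, h2]; simp

end SympMan
-- Differential calculus on products of symplectic manifolds
namespace SympMan

section Prod

variable {M X Y Z : SympMan.{u}}

theorem prod_I (X Y : SympMan.{u}) : (X.prod Y).I = X.I.prod Y.I := modelWithCornersSelf_prod

/-- The linear projection to the first factor. -/
noncomputable def dfst (X Y : SympMan.{u}) : (X.prod Y).model →L[ℝ] X.model :=
  ContinuousLinearMap.fst ℝ X.model Y.model

/-- The linear projection to the second factor. -/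
noncomputable def dsnd (X Y : SympMan.{u}) : (X.prod Y).model →L[ℝ] Y.model :=
  ContinuousLinearMap.snd ℝ X.model Y.model

/-- The linear map into a product with given components. -/
noncomputable def dpair (D : M.model →L[ℝ] X.model) (D' : M.model →L[ℝ] Y.model) :
    M.model →L[ℝ] (X.prod Y).model :=
  ContinuousLinearMap.prod D D'

theorem mem_tangentSet_prod {S : Set X} {T : Set Y} {p : X.prod Y} {v : (X.prod Y).model} :
    v ∈ tangentSet (M := X.prod Y) (X.prod Y).I (S ×ˢ T) p ↔
      v.1 ∈ tangentSet X.I S p.1 ∧ v.2 ∈ tangentSet Y.I T p.2 :=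
  WehrheimWoodward.mem_tangentSet_prod (I := X.I) (J := Y.I) (S := S) (T := T) (p := p) (v := v)

theorem smooth_fst : ContMDiff (X.prod Y).I X.I ∞ (fun p : X.prod Y => p.1) :=
  contMDiff_fst (I := X.I) (J := Y.I)

theorem smooth_snd : ContMDiff (X.prod Y).I Y.I ∞ (fun p : X.prod Y => p.2) :=
  contMDiff_snd (I := X.I) (J := Y.I)

theorem smooth_prodMk {f : M → X} {g : M → Y} (hf : ContMDiff M.I X.I ∞ f)
    (hg : ContMDiff M.I Y.I ∞ g) :
    ContMDiff (M' := X.prod Y) M.I (X.prod Y).I ∞ (fun p => (f p, g p)) :=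
  hf.prodMk hg

theorem deriv_fst (p : X.prod Y) :
    HasMFDerivAt (X.prod Y).I X.I (fun p : X.prod Y => p.1) p (dfst X Y) :=
  hasMFDerivAt_fst (I := X.I) (I' := Y.I) p

theorem deriv_snd (p : X.prod Y) :
    HasMFDerivAt (X.prod Y).I Y.I (fun p : X.prod Y => p.2) p (dsnd X Y) :=
  hasMFDerivAt_snd (I := X.I) (I' := Y.I) p

theorem deriv_comp {f : X → Y} {g : M → X} {p : M} {D : X.model →L[ℝ] Y.model}
    {D' : M.model →L[ℝ] X.model} (hf : HasMFDerivAt X.I Y.I f (g p) D)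
    (hg : HasMFDerivAt M.I X.I g p D') :
    HasMFDerivAt M.I Y.I (fun p => f (g p)) p (D.comp D') :=
  HasMFDerivAt.comp (I'' := Y.I) p hf hg

theorem deriv_prodMk {f : M → X} {g : M → Y} {p : M} {D : M.model →L[ℝ] X.model}
    {D' : M.model →L[ℝ] Y.model} (hf : HasMFDerivAt M.I X.I f p D)
    (hg : HasMFDerivAt M.I Y.I g p D') :
    HasMFDerivAt (M' := X.prod Y) M.I (X.prod Y).I (fun p => (f p, g p)) p (dpair D D') :=
  hf.prodMk hg

theorem isSubmanifold_prod_I {S : Set (X.prod Y)} :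
    IsSubmanifold (X.prod Y).I S ↔ IsSubmanifold (M := X × Y) (X.I.prod Y.I) S := by
  -- The model of the product is abstracted to a variable so that the equality of the two models can
  -- be substituted.
  have : ∀ J : ModelWithCorners ℝ (X.prod Y).model (X.prod Y).model, J = X.I.prod Y.I →
      (IsSubmanifold (M := X.prod Y) J S ↔ IsSubmanifold (M := X × Y) (X.I.prod Y.I) S) := by
    rintro J rfl
    exact Iff.rfl
  exact this _ (prod_I X Y)

end Prod
end SympMan

/-- A closed Lagrangian submanifold of a symplectic manifold. -/
structure IsLagSub (N : SympMan.{u}) (S : Set N) : Prop where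
  closed : IsClosed S
  submanifold : IsSubmanifold N.I S
  lagrangian : ∀ p ∈ S, ∀ v : N.model, v ∈ tangentSet N.I S p ↔
    ∀ w : N.model, w ∈ tangentSet N.I S p → N.om p v w = 0

/-! ### Lagrangian submanifolds and maps that rescale the form -/

section

variable {X Y Z M N : SympMan.{u}}

theorem prod_neg_om (p : X × Y) (v w : X.model × Y.model) :
    (X.prod Y.neg).om p v w = twistedForm p v w :=
  (SympMan.prod_om X Y.neg p v w).trans (sub_eq_add_neg _ _).symm

theorem prod_neg_om_eq_zero_iff (p : X × Y) (v w : X.model × Y.model) :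
    (X.prod Y.neg).om p v w = 0 ↔ twistedForm p v w = 0 := by
  rw [← prod_neg_om]

theorem CanRel.isLagSub (f : CanRel X Y) : IsLagSub (X.prod Y.neg) f.graph where
  closed := f.smooth.1
  submanifold := (SympMan.isSubmanifold_prod_I (X := X) (Y := Y.neg)).2 f.smooth.2
  lagrangian p hp v := (f.lagrangian p hp v).trans
    (forall₂_congr fun w _ => (prod_neg_om_eq_zero_iff (X := X) (Y := Y) p v w).symm)

/-- The canonical relation given by a closed Lagrangian submanifold of `X × Ȳ`. -/
def IsLagSub.toCanRel {S : Set (X × Y)} (h : IsLagSub (X.prod Y.neg) S) : CanRel X Y where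
  graph := S
  smooth := ⟨h.closed, (SympMan.isSubmanifold_prod_I (X := X) (Y := Y.neg)).1 h.submanifold⟩
  lagrangian p hp v := (h.lagrangian p hp v).trans
    (forall₂_congr fun w _ => prod_neg_om_eq_zero_iff (X := X) (Y := Y) p v w)

theorem IsLagSub.prod {S : Set M} {T : Set N} (hS : IsLagSub M S) (hT : IsLagSub N T) :
    IsLagSub (M.prod N) (S ×ˢ T) where
  closed := hS.closed.prod hT.closed
  submanifold := SympMan.isSubmanifold_prod_I.2 (hS.submanifold.prod hT.submanifold)
  lagrangian p hp v := by
    constructor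
    · intro hv w hw
      rw [SympMan.mem_tangentSet_prod] at hv hw
      rw [SympMan.prod_om, (hS.lagrangian _ hp.1 _).1 hv.1 _ hw.1,
        (hT.lagrangian _ hp.2 _).1 hv.2 _ hw.2, add_zero]
    · intro h
      refine SympMan.mem_tangentSet_prod.2 ⟨(hS.lagrangian _ hp.1 _).2 fun w hw => ?_,
        (hT.lagrangian _ hp.2 _).2 fun w hw => ?_⟩
      · have := (SympMan.prod_om M N p v (w, 0)).symm.trans <| h (w, 0)
          (SympMan.mem_tangentSet_prod.2 ⟨hw, zero_mem_tangentSet hp.2⟩)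
        exact (add_eq_left.2 (N.om_zero_right p.2 v.2)).symm.trans this
      · have := (SympMan.prod_om M N p v (0, w)).symm.trans <| h (0, w)
          (SympMan.mem_tangentSet_prod.2 ⟨zero_mem_tangentSet hp.1, hw⟩)
        exact (add_eq_right.2 (M.om_zero_right p.1 v.1)).symm.trans this

/-- A diffeomorphism with constant derivative which multiplies the symplectic form by a nonzero
constant. -/
structure ScaledIso (M N : SympMan.{u}) where
  toEquiv : M ≃ N
  deriv : M.model ≃L[ℝ] N.model
  scale : ℝ
  scale_ne : scale ≠ 0
  smooth : ContMDiff M.I N.I ∞ toEquiv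
  smooth_symm : ContMDiff N.I M.I ∞ toEquiv.symm
  hasMFDerivAt : ∀ p, HasMFDerivAt M.I N.I toEquiv p (deriv : M.model →L[ℝ] N.model)
  hasMFDerivAt_symm : ∀ p, HasMFDerivAt N.I M.I toEquiv.symm p
    (deriv.symm : N.model →L[ℝ] M.model)
  om : ∀ p v w, N.om (toEquiv p) (deriv v) (deriv w) = scale * M.om p v w

theorem ScaledIso.mem_tangentSet (Φ : ScaledIso M N) {S : Set N} {p : M} {v : M.model} :
    v ∈ tangentSet M.I (Φ.toEquiv ⁻¹' S) p ↔ Φ.deriv v ∈ tangentSet N.I S (Φ.toEquiv p) :=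
  mem_tangentSet_preimage Φ.toEquiv Φ.deriv Φ.hasMFDerivAt Φ.hasMFDerivAt_symm

/-- Being one's own orthogonal depends only on where the form vanishes, so any nonzero factor is
harmless. The factor `-1` covers passing to the opposite manifold and transposing a relation. -/
theorem IsLagSub.preimage {S : Set N} (hS : IsLagSub N S) (Φ : ScaledIso M N) :
    IsLagSub M (Φ.toEquiv ⁻¹' S) where
  closed := hS.closed.preimage Φ.smooth.continuous
  submanifold := hS.submanifold.preimage Φ.toEquiv Φ.deriv.symm Φ.smooth Φ.smooth_symm
  lagrangian p hp v := by
    simp_rw [Φ.mem_tangentSet]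
    rw [hS.lagrangian _ hp]
    constructor
    · intro h w hw
      have := h _ hw
      rw [Φ.om] at this
      exact (mul_eq_zero.1 this).resolve_left Φ.scale_ne
    · intro h w hw
      have := h (Φ.deriv.symm w) (by simpa using hw)
      have h2 := Φ.om p v (Φ.deriv.symm w)
      rwa [this, mul_zero, Φ.deriv.apply_symm_apply] at h2


open SympMan in
/-- Regrouping of the factors of `X × Q × M`, where the forms of `Q` and `M` are reversed. -/
noncomputable def regroupTarget (X Q M : SympMan.{u}) :
    ScaledIso (X.prod (Q.prod M).neg) ((X.prod Q.neg).prod M.neg) where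
  toEquiv := (Equiv.prodAssoc X Q M).symm
  deriv := ContinuousLinearEquiv.equivOfInverse
    (dpair (X := X.prod Q.neg) (Y := M.neg)
      (dpair (Y := Q.neg) (dfst X (Q.prod M).neg) ((dfst Q M).comp (dsnd X (Q.prod M).neg)))
      ((dsnd Q M).comp (dsnd X (Q.prod M).neg)))
    (dpair (X := X) (Y := (Q.prod M).neg)
      ((dfst X Q.neg).comp (dfst (X.prod Q.neg) M.neg))
      (dpair (X := Q) (Y := M)
        ((dsnd X Q.neg).comp (dfst (X.prod Q.neg) M.neg)) (dsnd (X.prod Q.neg) M.neg)))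
    (fun _ => rfl) (fun _ => rfl)
  scale := 1
  scale_ne := one_ne_zero
  smooth := smooth_prodMk
    (smooth_prodMk smooth_fst (smooth_fst (X := Q) (Y := M) |>.comp smooth_snd))
    (smooth_snd (X := Q) (Y := M) |>.comp smooth_snd)
  smooth_symm := smooth_prodMk (smooth_fst.comp smooth_fst)
    (smooth_prodMk (X := Q) (Y := M) (smooth_snd.comp smooth_fst) smooth_snd)
  hasMFDerivAt p := deriv_prodMk (deriv_prodMk (deriv_fst _)
    (deriv_comp (deriv_fst (X := Q) (Y := M) _) (deriv_snd p)))
    (deriv_comp (deriv_snd (X := Q) (Y := M) _) (deriv_snd p))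
  hasMFDerivAt_symm p := deriv_prodMk (deriv_comp (deriv_fst _) (deriv_fst p))
    (deriv_prodMk (X := Q) (Y := M) (deriv_comp (deriv_snd _) (deriv_fst p)) (deriv_snd p))
  om p v w := by
    obtain ⟨x, q, m⟩ := p
    obtain ⟨v₁, v₂, v₃⟩ := v
    obtain ⟨w₁, w₂, w₃⟩ := w
    have h1 : (X.prod (Q.prod M).neg).om (x, (q, m)) (v₁, (v₂, v₃)) (w₁, (w₂, w₃)) =
        X.om x v₁ w₁ + -(Q.om q v₂ w₂ + M.om m v₃ w₃) := by
      rw [← prod_om Q M (q, m) (v₂, v₃) (w₂, w₃)]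
      exact prod_om X _ _ _ _
    have h2 : ((X.prod Q.neg).prod M.neg).om ((x, q), m) ((v₁, v₂), v₃) ((w₁, w₂), w₃) =
        (X.om x v₁ w₁ + -Q.om q v₂ w₂) + -M.om m v₃ w₃ := by
      rw [← neg_om Q, ← prod_om X Q.neg (x, q) (v₁, v₂) (w₁, w₂)]
      exact prod_om (X.prod Q.neg) M.neg ((x, q), m) ((v₁, v₂), v₃) ((w₁, w₂), w₃)
    refine h2.trans (Eq.trans ?_ (congrArg (1 * ·) h1.symm))
    ring

end

/-! ### Graphs of maps as submanifolds -/

section Graph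

variable {E H : Type*} [NormedAddCommGroup E] [NormedSpace ℝ E] [TopologicalSpace H]
  {I : ModelWithCorners ℝ E H} {M : Type*} [TopologicalSpace M] [ChartedSpace H M]
  {N : Type*} [TopologicalSpace N] [ChartedSpace H N]

/-- In charts that read `φ` as the identity, the graph becomes the diagonal of `E × E`. This is
enough for the identity map and for the inclusion into a disjoint union. -/
theorem isSubmanifold_graph [IsManifold I ∞ M] [IsManifold I ∞ N] {φ : M → N}
    (h : ∀ p, ∃ e ∈ IsManifold.maximalAtlas I ∞ M, ∃ e' ∈ IsManifold.maximalAtlas I ∞ N,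
      p ∈ e.source ∧ ∀ q ∈ e.source, φ q ∈ e'.source ∧ e' (φ q) = e q) :
    IsSubmanifold (I.prod I) {p : M × N | p.2 = φ p.1} := by
  rintro ⟨p, r⟩ (rfl : r = φ p)
  obtain ⟨e, he, e', he', hp, hφ⟩ := h p
  refine ⟨e.prod e', IsManifold.mem_maximalAtlas_prod he he', ⟨hp, (hφ p hp).1⟩,
    LinearMap.eqLocus (LinearMap.fst ℝ E E) (LinearMap.snd ℝ E E), ?_⟩
  rintro ⟨q, r⟩ ⟨hq, hr⟩
  change r = φ q ↔ I (e q) = I (e' r)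
  rw [← (hφ q hq).2, I.injective.eq_iff, e'.injOn.eq_iff (hφ q hq).1 hr, eq_comm]

variable {E' H' : Type*} [NormedAddCommGroup E'] [NormedSpace ℝ E'] [TopologicalSpace H']
  {J : ModelWithCorners ℝ E' H'} {N' : Type*} [TopologicalSpace N'] [ChartedSpace H' N']

/-- Along a curve in the graph the second component is `φ` of the first, so uniqueness of
derivatives gives one direction. For the other, tangent vectors of `M` are pushed forward by `q ↦
(q, φ q)`. -/
theorem mem_tangentSet_graph [I.Boundaryless] {φ : M → N'} {D : E →L[ℝ] E'} {p : M}
    (hφ : HasMFDerivAt I J φ p D) {v : E × E'} :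
    v ∈ tangentSet (I.prod J) {p : M × N' | p.2 = φ p.1} (p, φ p) ↔ v.2 = D v.1 := by
  constructor
  · intro h
    obtain ⟨γ, h0, hS, hγ⟩ := h
    have h1 : HasMFDerivAt 𝓘(ℝ, ℝ) I (fun t => (γ t).1) 0
        ((ContinuousLinearMap.fst ℝ E E').comp
          (ContinuousLinearMap.toSpanSingleton ℝ v) : ℝ →L[ℝ] E) :=
      HasMFDerivAt.comp (I'' := I) 0 (hasMFDerivAt_fst (γ 0)) hγ
    have h2 : HasMFDerivAt 𝓘(ℝ, ℝ) J (fun t => (γ t).2) 0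
        ((ContinuousLinearMap.snd ℝ E E').comp
          (ContinuousLinearMap.toSpanSingleton ℝ v) : ℝ →L[ℝ] E') :=
      HasMFDerivAt.comp (I'' := J) 0 (hasMFDerivAt_snd (γ 0)) hγ
    have h3 : HasMFDerivAt 𝓘(ℝ, ℝ) J (fun t => φ (γ t).1) 0
        (D.comp ((ContinuousLinearMap.fst ℝ E E').comp
          (ContinuousLinearMap.toSpanSingleton ℝ v)) : ℝ →L[ℝ] E') := by
      refine HasMFDerivAt.comp (I'' := J) (g := φ) 0 ?_ h1
      rw [h0]
      exact hφ
    have h4 := h3.congr_of_eventuallyEq (f₁ := fun t => (γ t).2) hS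
    have := hasMFDerivAt_unique h2 h4
    have h5 : (1 : ℝ) • v.2 = D ((1 : ℝ) • v.1) := DFunLike.congr_fun this (1 : ℝ)
    simpa using h5
  · rintro h
    have hd := (hasMFDerivAt_id (I := I) p).prodMk hφ
    have := map_mem_tangentSet (T := {p : M × N' | p.2 = φ p.1})
      (D := (ContinuousLinearMap.id ℝ E).prod D) hd (Filter.Eventually.of_forall fun q _ => rfl)
      (mem_tangentSet_univ p v.1)
    have hv : v = ((ContinuousLinearMap.id ℝ E).prod D) v.1 := Prod.ext rfl h
    rw [hv]
    exact this

end Graph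

section

variable {X Y Z M N : SympMan.{u}}

/-- This is the linear algebra behind Lagrangian graphs: `(a, b)` is orthogonal to the graph of a
symplectic isomorphism exactly when it lies on it, since `a - D⁻¹ b` is then orthogonal to
everything and the form is nondegenerate. -/
theorem eq_iff_forall_om_eq {x : X} {y : N} (D : X.model ≃L[ℝ] N.model)
    (hom : ∀ v w, N.om y (D v) (D w) = X.om x v w) (a : X.model) (b : N.model) :
    b = D a ↔ ∀ w w', w' = D w → X.om x a w + -N.om y b w' = 0 := by
  constructor
  · rintro rfl w _ rfl
    rw [hom, add_neg_cancel]
  · intro h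
    have : a - D.symm b = 0 := by
      refine X.om_nondegenerate (x := x) fun w => ?_
      have h1 := h w _ rfl
      have h2 := hom (D.symm b) w
      rw [D.apply_symm_apply] at h2
      rw [sub_eq_add_neg, ← neg_one_smul ℝ, SympMan.om_add_left, SympMan.om_smul_left, ← h2]
      linarith
    rw [sub_eq_zero.1 this]
    simp

/-- The graph of a symplectic map with constant invertible derivative is Lagrangian. -/
theorem isLagSub_graph {φ : X → N} (D : X.model ≃L[ℝ] N.model)
    (hφ : ∀ x, HasMFDerivAt X.I N.I φ x (D : X.model →L[ℝ] N.model))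
    (hom : ∀ x v w, N.om (φ x) (D v) (D w) = X.om x v w)
    (hsub : IsSubmanifold (M := X × N) (X.I.prod N.I) {p : X × N | p.2 = φ p.1}) :
    IsLagSub (X.prod N.neg) {p : X × N | p.2 = φ p.1} where
  closed := by
    have hc : Continuous φ := continuous_iff_continuousAt.2 fun x => (hφ x).continuousAt
    exact isClosed_eq (f := fun p : X × N => p.2) continuous_snd (hc.comp continuous_fst)
  submanifold := (SympMan.isSubmanifold_prod_I (X := X) (Y := N.neg)).2 hsub
  lagrangian := by
    rintro ⟨x, y⟩ (rfl : y = φ x) v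
    have key (v : X.model × N.model) :
        v ∈ tangentSet (M := X.prod N.neg) (X.prod N.neg).I {p : X × N | p.2 = φ p.1} (x, φ x) ↔
        v.2 = D v.1 := mem_tangentSet_graph (hφ x)
    refine (key v).trans ((eq_iff_forall_om_eq D (hom x) v.1 v.2).trans ?_)
    have hom' (w : X.model × N.model) : (X.prod N.neg).om (x, φ x) v w =
        X.om x v.1 w.1 + -N.om (φ x) v.2 w.2 := SympMan.prod_om X N.neg (x, φ x) v w
    exact ⟨fun h w hw => (hom' w).trans (h _ _ ((key w).1 hw)),
      fun h w w' hw => (hom' (w, w')).symm.trans (h (w, w') ((key (w, w')).2 hw))⟩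

theorem isLagSub_diagonal (X : SympMan.{u}) : IsLagSub (X.prod X.neg) (Set.diagonal X) := by
  have : {p : X × X | p.2 = id p.1} = Set.diagonal X := by
    ext p
    exact eq_comm
  rw [← this]
  refine isLagSub_graph (ContinuousLinearEquiv.refl ℝ X.model) (fun x => hasMFDerivAt_id x)
    (fun _ _ _ => rfl) (isSubmanifold_graph fun p => ?_)
  exact ⟨chartAt X.model p, IsManifold.chart_mem_maximalAtlas p, chartAt X.model p,
    IsManifold.chart_mem_maximalAtlas p, mem_chart_source _ p, fun q hq => ⟨hq, rfl⟩⟩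

theorem isLagSub_inl (X : SympMan.{u}) (x₀ : X) :
    IsLagSub (X.prod (X.sumTangent x₀).neg) {p : X × X.sumTangent x₀ | p.2 = X.inl x₀ p.1} := by
  refine isLagSub_graph (N := X.sumTangent x₀) (ContinuousLinearEquiv.refl ℝ X.model)
    (fun x => hasMFDerivAt_inl (I := X.I) (M' := X.model) (p := .inl x₀)) (fun _ _ _ => rfl)
    (isSubmanifold_graph (I := X.I) (M := X) (N := X ⊕ X.model) fun p => ?_)
  refine ⟨chartAt X.model p, IsManifold.chart_mem_maximalAtlas p,
    chartAt X.model (Sum.inl p : X ⊕ X.model),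
    IsManifold.chart_mem_maximalAtlas _, mem_chart_source _ p, fun q hq => ⟨?_, ?_⟩⟩
  · rw [ChartedSpace.sum_chartAt_inl]
    exact ⟨q, hq, rfl⟩
  · exact sum_chartAt_inl_apply

theorem isSubmanifold_inr (X : SympMan.{u}) (W : Submodule ℝ X.model) :
    IsSubmanifold (M := X ⊕ X.model) X.I (Sum.inr '' (W : Set X.model)) := by
  rintro _ ⟨p, hp, rfl⟩
  refine ⟨chartAt X.model (Sum.inr p : X ⊕ X.model),
    IsManifold.chart_mem_maximalAtlas _, mem_chart_source _ _, W, ?_⟩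
  intro q hq
  rw [ChartedSpace.sum_chartAt_inr] at hq
  obtain ⟨q, -, rfl⟩ := hq
  have : (chartAt X.model (Sum.inr p : X ⊕ X.model)).extend X.I (Sum.inr q) = q := by
    simp only [mfld_simps]
    rfl
  rw [this, Sum.inr_injective.mem_set_image]
  rfl

theorem mem_tangentSet_inr (X : SympMan.{u}) (x₀ : X) {W : Submodule ℝ X.model} {p v : X.model}
    (hp : p ∈ W) : v ∈ tangentSet (M := X ⊕ X.model) X.I (Sum.inr '' (W : Set X.model))
      (Sum.inr p) ↔ v ∈ W := by
  have hinr : HasMFDerivAt X.I X.I (Sum.inr : X.model → X ⊕ X.model) p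
    (ContinuousLinearMap.id ℝ X.model) :=
      hasMFDerivAt_inr (I := X.I) (M := X) (M' := X.model) (p := .inl x₀)
  constructor
  · intro h
    -- Collapsing the component `X` to `0` is a smooth retraction onto the vector space; its
    -- derivative inverts that of `Sum.inr`, so it carries tangency into `W`.
    have hc : ContMDiff X.I 𝓘(ℝ, X.model) ∞
        (Sum.elim (fun _ => 0) id : X ⊕ X.model → X.model) :=
      contMDiff_const.sumElim contMDiff_id
    have hd := (hc.mdifferentiableAt (x := Sum.inr p) (by simp)).hasMFDerivAt
    have he := hasMFDerivAt_unique (HasMFDerivAt.comp (I'' := 𝓘(ℝ, X.model)) p hd hinr)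
      (hasMFDerivAt_id p)
    have := mem_submodule_of_mem_tangentSet W hd (S := Sum.inr '' (W : Set X.model)) ?_ h
    · exact (congrArg (· ∈ W) (DFunLike.congr_fun he v)).mp this
    · refine Filter.Eventually.of_forall ?_
      rintro _ ⟨q, hq, rfl⟩
      exact hq
  · intro h
    exact map_mem_tangentSet (T := Sum.inr '' (W : Set X.model)) hinr
      (Filter.Eventually.of_forall fun q hq => Set.mem_image_of_mem _ hq)
      ((mem_tangentSet_submodule hp).2 h)

theorem isLagSub_inr (X : SympMan.{u}) (x₀ : X) {W : Submodule ℝ X.model}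
    (hW : ∀ v, v ∈ W ↔ ∀ w ∈ W, X.om x₀ v w = 0) :
    IsLagSub (X.sumTangent x₀) (X.inr x₀ '' (W : Set X.model)) where
  closed := (Topology.IsClosedEmbedding.inr (X := X) (Y := X.model)).isClosedMap _
    W.closed_of_finiteDimensional
  submanifold := isSubmanifold_inr X W
  lagrangian := by
    rintro _ ⟨p, hp, rfl⟩ v
    have key (v : X.model) := mem_tangentSet_inr (v := v) X x₀ hp
    exact (key v).trans ((hW v).trans (forall_congr' fun w => imp_congr (key w).symm Iff.rfl))

end

/-! ### Sign changes and regroupings of factors -/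

section

open SympMan

theorem prod_om_eq {X Y : SympMan.{u}} {p : X.prod Y} {v w : (X.prod Y).model} {a b : ℝ}
    (ha : X.om p.1 v.1 w.1 = a) (hb : Y.om p.2 v.2 w.2 = b) : (X.prod Y).om p v w = a + b := by
  rw [prod_om, ha, hb]

theorem neg_om_eq {X : SympMan.{u}} {p : X} {v w : X.model} {a : ℝ} (ha : X.om p v w = a) :
    X.neg.om p v w = -a := by
  rw [neg_om, ha]

/-- The identity, as a map between a symplectic manifold and its opposite. -/
noncomputable def negIso (M : SympMan.{u}) : ScaledIso M.neg M where
  toEquiv := Equiv.refl M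
  deriv := ContinuousLinearEquiv.refl ℝ M.model
  scale := -1
  scale_ne := by norm_num
  smooth := contMDiff_id (I := M.I) (M := M)
  smooth_symm := contMDiff_id (I := M.I) (M := M)
  hasMFDerivAt p := hasMFDerivAt_id (I := M.I) (M := M) p
  hasMFDerivAt_symm p := hasMFDerivAt_id (I := M.I) (M := M) p
  om p v w := by
    have : M.neg.om p v w = -M.om p v w := neg_om M p v w
    rw [this, neg_mul_neg, one_mul]
    rfl

/-- The exchange of the two factors of `X × Ȳ`. -/
noncomputable def swapIso (X Y : SympMan.{u}) : ScaledIso (Y.prod X.neg) (X.prod Y.neg) where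
  toEquiv := Equiv.prodComm Y X
  deriv := ContinuousLinearEquiv.equivOfInverse
    (dpair (X := X) (Y := Y.neg) (dsnd Y X.neg) (dfst Y X.neg))
    (dpair (X := Y) (Y := X.neg) (dsnd X Y.neg) (dfst X Y.neg)) (fun _ => rfl) (fun _ => rfl)
  scale := -1
  scale_ne := by norm_num
  smooth := smooth_prodMk (X := X) (Y := Y.neg) (smooth_snd (X := Y) (Y := X.neg))
    (smooth_fst (X := Y) (Y := X.neg))
  smooth_symm := smooth_prodMk (X := Y) (Y := X.neg) (smooth_snd (X := X) (Y := Y.neg))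
    (smooth_fst (X := X) (Y := Y.neg))
  hasMFDerivAt p := deriv_prodMk (X := X) (Y := Y.neg) (deriv_snd (X := Y) (Y := X.neg) p)
    (deriv_fst (X := Y) (Y := X.neg) p)
  hasMFDerivAt_symm p := deriv_prodMk (X := Y) (Y := X.neg) (deriv_snd (X := X) (Y := Y.neg) p)
    (deriv_fst (X := X) (Y := Y.neg) p)
  om p v w := by
    obtain ⟨y, x⟩ := p
    obtain ⟨v₁, v₂⟩ := v
    obtain ⟨w₁, w₂⟩ := w
    have h1 : (Y.prod X.neg).om (y, x) (v₁, v₂) (w₁, w₂) = Y.om y v₁ w₁ + -X.om x v₂ w₂ :=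
      prod_om Y X.neg _ _ _
    have h2 : (X.prod Y.neg).om (x, y) (v₂, v₁) (w₂, w₁) = X.om x v₂ w₂ + -Y.om y v₁ w₁ :=
      prod_om X Y.neg _ _ _
    refine h2.trans (Eq.trans ?_ (congrArg (-1 * ·) h1.symm))
    ring

/-- Regrouping of the factors of `M × Y × Z`, where the form of `Z` is reversed. -/
noncomputable def regroupSource (M Y Z : SympMan.{u}) :
    ScaledIso ((M.prod Y).prod Z.neg) (M.prod (Y.prod Z.neg)) where
  toEquiv := Equiv.prodAssoc M Y Z
  deriv := ContinuousLinearEquiv.equivOfInverse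
    (dpair (X := M) (Y := Y.prod Z.neg) ((dfst M Y).comp (dfst (M.prod Y) Z.neg))
      (dpair (X := Y) (Y := Z.neg) ((dsnd M Y).comp (dfst (M.prod Y) Z.neg))
        (dsnd (M.prod Y) Z.neg)))
    (dpair (X := M.prod Y) (Y := Z.neg)
      (dpair (X := M) (Y := Y) (dfst M (Y.prod Z.neg))
        ((dfst Y Z.neg).comp (dsnd M (Y.prod Z.neg))))
      ((dsnd Y Z.neg).comp (dsnd M (Y.prod Z.neg))))
    (fun _ => rfl) (fun _ => rfl)
  scale := 1
  scale_ne := one_ne_zero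
  smooth := smooth_prodMk (smooth_fst.comp smooth_fst)
    (smooth_prodMk (smooth_snd.comp smooth_fst) smooth_snd)
  smooth_symm := smooth_prodMk (smooth_prodMk smooth_fst (smooth_fst.comp smooth_snd))
    (smooth_snd.comp smooth_snd)
  hasMFDerivAt p := deriv_prodMk (deriv_comp (deriv_fst _) (deriv_fst p))
    (deriv_prodMk (deriv_comp (deriv_snd _) (deriv_fst p)) (deriv_snd p))
  hasMFDerivAt_symm p := deriv_prodMk (deriv_prodMk (deriv_fst _)
    (deriv_comp (deriv_fst _) (deriv_snd p))) (deriv_comp (deriv_snd _) (deriv_snd p))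
  om p v w := by
    obtain ⟨⟨x, q⟩, m⟩ := p
    obtain ⟨⟨v₁, v₂⟩, v₃⟩ := v
    obtain ⟨⟨w₁, w₂⟩, w₃⟩ := w
    have h1 : ((M.prod Y).prod Z.neg).om ((x, q), m) ((v₁, v₂), v₃) ((w₁, w₂), w₃) =
        (M.om x v₁ w₁ + Y.om q v₂ w₂) + -Z.om m v₃ w₃ :=
      prod_om_eq (prod_om_eq rfl rfl) (neg_om_eq rfl)
    have h2 : (M.prod (Y.prod Z.neg)).om (x, (q, m)) (v₁, (v₂, v₃)) (w₁, (w₂, w₃)) =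
        M.om x v₁ w₁ + (Y.om q v₂ w₂ + -Z.om m v₃ w₃) :=
      prod_om_eq rfl (prod_om_eq rfl (neg_om_eq rfl))
    refine h2.trans (Eq.trans ?_ (congrArg (1 * ·) h1.symm))
    ring

/-- Regrouping of the factors of `Q × Y' × Y × Z`, where the forms of `Y'` and `Z` are reversed. -/
noncomputable def regroupMiddle (Q Y' Y Z : SympMan.{u}) :
    ScaledIso ((Q.prod (Y'.neg.prod Y)).prod Z.neg) ((Q.prod Y'.neg).prod (Y.prod Z.neg)) where
  toEquiv :=
    ⟨fun p => ((p.1.1, p.1.2.1), (p.1.2.2, p.2)), fun p => ((p.1.1, (p.1.2, p.2.1)), p.2.2),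
      fun _ => rfl, fun _ => rfl⟩
  deriv := ContinuousLinearEquiv.equivOfInverse
    (dpair (X := Q.prod Y'.neg) (Y := Y.prod Z.neg)
      (dpair ((dfst Q (Y'.neg.prod Y)).comp (dfst (Q.prod (Y'.neg.prod Y)) Z.neg))
        ((dfst Y'.neg Y).comp ((dsnd Q (Y'.neg.prod Y)).comp (dfst (Q.prod (Y'.neg.prod Y)) Z.neg))))
      (dpair ((dsnd Y'.neg Y).comp
          ((dsnd Q (Y'.neg.prod Y)).comp (dfst (Q.prod (Y'.neg.prod Y)) Z.neg)))
        (dsnd (Q.prod (Y'.neg.prod Y)) Z.neg)))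
    (dpair (X := Q.prod (Y'.neg.prod Y)) (Y := Z.neg)
      (dpair ((dfst Q Y'.neg).comp (dfst (Q.prod Y'.neg) (Y.prod Z.neg)))
        (dpair ((dsnd Q Y'.neg).comp (dfst (Q.prod Y'.neg) (Y.prod Z.neg)))
          ((dfst Y Z.neg).comp (dsnd (Q.prod Y'.neg) (Y.prod Z.neg)))))
      ((dsnd Y Z.neg).comp (dsnd (Q.prod Y'.neg) (Y.prod Z.neg))))
    (fun _ => rfl) (fun _ => rfl)
  scale := 1
  scale_ne := one_ne_zero
  smooth := smooth_prodMk
    (smooth_prodMk (smooth_fst.comp smooth_fst) (smooth_fst.comp (smooth_snd.comp smooth_fst)))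
    (smooth_prodMk (smooth_snd.comp (smooth_snd.comp smooth_fst)) smooth_snd)
  smooth_symm := smooth_prodMk
    (smooth_prodMk (smooth_fst.comp smooth_fst)
      (smooth_prodMk (smooth_snd.comp smooth_fst) (smooth_fst.comp smooth_snd)))
    (smooth_snd.comp smooth_snd)
  hasMFDerivAt p := deriv_prodMk
    (deriv_prodMk (deriv_comp (deriv_fst _) (deriv_fst p))
      (deriv_comp (deriv_fst _) (deriv_comp (deriv_snd _) (deriv_fst p))))
    (deriv_prodMk (deriv_comp (deriv_snd _) (deriv_comp (deriv_snd _) (deriv_fst p)))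
      (deriv_snd p))
  hasMFDerivAt_symm p := deriv_prodMk
    (deriv_prodMk (deriv_comp (deriv_fst _) (deriv_fst p))
      (deriv_prodMk (deriv_comp (deriv_snd _) (deriv_fst p))
        (deriv_comp (deriv_fst _) (deriv_snd p))))
    (deriv_comp (deriv_snd _) (deriv_snd p))
  om p v w := by
    obtain ⟨⟨q, ⟨y', y⟩⟩, z⟩ := p
    obtain ⟨⟨v₁, ⟨v₂, v₃⟩⟩, v₄⟩ := v
    obtain ⟨⟨w₁, ⟨w₂, w₃⟩⟩, w₄⟩ := w
    have h1 : ((Q.prod (Y'.neg.prod Y)).prod Z.neg).om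
        ((q, (y', y)), z) ((v₁, (v₂, v₃)), v₄) ((w₁, (w₂, w₃)), w₄) =
        (Q.om q v₁ w₁ + (-Y'.om y' v₂ w₂ + Y.om y v₃ w₃)) + -Z.om z v₄ w₄ :=
      prod_om_eq (prod_om_eq rfl (prod_om_eq (neg_om_eq rfl) rfl)) (neg_om_eq rfl)
    have h2 : ((Q.prod Y'.neg).prod (Y.prod Z.neg)).om
        ((q, y'), (y, z)) ((v₁, v₂), (v₃, v₄)) ((w₁, w₂), (w₃, w₄)) =
        (Q.om q v₁ w₁ + -Y'.om y' v₂ w₂) + (Y.om y v₃ w₃ + -Z.om z v₄ w₄) :=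
      prod_om_eq (prod_om_eq rfl (neg_om_eq rfl)) (prod_om_eq rfl (neg_om_eq rfl))
    refine h2.trans (Eq.trans ?_ (congrArg (1 * ·) h1.symm))
    ring

end

/-! ### Operations on canonical relations -/

section

open SympMan

variable {X Y Z Q M : SympMan.{u}}

theorem IsLagSub.neg {S : Set M} (h : IsLagSub M S) : IsLagSub M.neg S :=
  h.preimage (negIso M)

/-- The transpose of a canonical relation. -/
noncomputable def CanRel.transpose (f : CanRel X Y) : CanRel Y X :=
  (f.isLagSub.preimage (swapIso X Y)).toCanRel

/-- The diagonal relation. -/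
noncomputable def CanRel.id (X : SympMan.{u}) : CanRel X X := (isLagSub_diagonal X).toCanRel

theorem isLagSub_diagonal' (X : SympMan.{u}) : IsLagSub (X.neg.prod X) (Set.diagonal X) where
  closed := isClosed_diagonal (X := X)
  submanifold := (isLagSub_diagonal X).submanifold
  lagrangian p hp v := by
    refine ((isLagSub_diagonal X).lagrangian p hp v).trans (forall₂_congr fun w hw => ?_)
    have h1 : (X.prod X.neg).om p v w = X.om p.1 v.1 w.1 + -X.om p.2 v.2 w.2 :=
      prod_om_eq rfl (neg_om_eq rfl)
    have h2 : (X.neg.prod X).om p v w = -X.om p.1 v.1 w.1 + X.om p.2 v.2 w.2 :=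
      prod_om_eq (neg_om_eq rfl) rfl
    exact ⟨fun h => h2.trans (by linarith [h1.symm.trans h]),
      fun h => h1.trans (by linarith [h2.symm.trans h])⟩

/-- The relation `{(x, (q, m)) | (x, q) ∈ f, m ∈ L}` for a closed Lagrangian submanifold `L`. -/
noncomputable def CanRel.extend (f : CanRel X Q) {L : Set M} (hL : IsLagSub M L) :
    CanRel X (Q.prod M) :=
  ((f.isLagSub.prod hL.neg).preimage (regroupTarget X Q M)).toCanRel

theorem CanRel.mem_tangentSet_extend {f : CanRel X Q} {L : Set M} {hL : IsLagSub M L}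
    {p : X × Q.prod M} {v : X.model × (Q.prod M).model} :
    v ∈ tangentSet (X.I.prod (Q.prod M).I) (f.extend hL).graph p ↔
      ((v.1, v.2.1) : X.model × Q.model) ∈ tangentSet (X.I.prod Q.I) f.graph (p.1, p.2.1) ∧
      v.2.2 ∈ tangentSet M.I L p.2.2 :=
  ((regroupTarget X Q M).mem_tangentSet (S := f.graph ×ˢ L) (p := p) (v := v)).trans
    (SympMan.mem_tangentSet_prod (X := X.prod Q.neg) (Y := M.neg))

/-- The relation `{((m, y), z) | m ∈ L, (y, z) ∈ f}` for a closed Lagrangian submanifold `L`. -/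
noncomputable def CanRel.coextend {L : Set M} (hL : IsLagSub M L) (f : CanRel Y Z) :
    CanRel (M.prod Y) Z :=
  ((hL.prod f.isLagSub).preimage (regroupSource M Y Z)).toCanRel

/-- The relation `{((q, (y', y)), z) | (q, y') ∈ f, (y, z) ∈ g}`. -/
noncomputable def CanRel.juxtapose {Y' : SympMan.{u}} (f : CanRel Q Y') (g : CanRel Y Z) :
    CanRel (Q.prod (Y'.neg.prod Y)) Z :=
  ((f.isLagSub.prod g.isLagSub).preimage (regroupMiddle Q Y' Y Z)).toCanRel

theorem CanRel.mem_tangentSet_juxtapose {Y' : SympMan.{u}} {f : CanRel Q Y'} {g : CanRel Y Z}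
    {p : Q.prod (Y'.neg.prod Y) × Z} {v : (Q.prod (Y'.neg.prod Y)).model × Z.model} :
    v ∈ tangentSet ((Q.prod (Y'.neg.prod Y)).I.prod Z.I) (f.juxtapose g).graph p ↔
      ((v.1.1, v.1.2.1) : Q.model × Y'.model) ∈
        tangentSet (Q.I.prod Y'.I) f.graph (p.1.1, p.1.2.1) ∧
      ((v.1.2.2, v.2) : Y.model × Z.model) ∈ tangentSet (Y.I.prod Z.I) g.graph (p.1.2.2, p.2) :=
  ((regroupMiddle Q Y' Y Z).mem_tangentSet (S := f.graph ×ˢ g.graph) (p := p) (v := v)).trans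
    (SympMan.mem_tangentSet_prod (X := Q.prod Y'.neg) (Y := Y.prod Z.neg))

theorem mem_tangentSet_diagonal {p : X × X} (hp : p ∈ Set.diagonal X)
    {v : X.model × X.model} :
    v ∈ tangentSet (X.I.prod X.I) (Set.diagonal X) p ↔ v.1 = v.2 := by
  obtain ⟨x, y⟩ := p
  obtain rfl : x = y := hp
  have : {p : X × X | p.2 = id p.1} = Set.diagonal X := by
    ext p
    exact eq_comm
  rw [← this]
  exact (mem_tangentSet_graph (φ := id) (D := ContinuousLinearMap.id ℝ X.model)
    (hasMFDerivAt_id x)).trans eq_comm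

end

/-- The continuous map `r` undoes `π` on `C`, so the restriction is injective and inducing. Its
range is cut out by the closed conditions `r b ∈ C` and `π (r b) = b`. This serves both for
projections of fibre products and for properness of projections of relations. -/
theorem isClosedEmbedding_restrict {α β : Type*} [TopologicalSpace α] [TopologicalSpace β]
    [T2Space β] {C : Set α} (hC : IsClosed C) {π : α → β} (hπ : Continuous π) {r : β → α}
    (hr : Continuous r) (h : ∀ c ∈ C, r (π c) = c) :
    Topology.IsClosedEmbedding (fun c : C => π c) := by
  have hcomp : r ∘ (fun c : C => π c) = Subtype.val := funext fun c => h c c.2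
  have hind : Topology.IsInducing (fun c : C => π c) :=
    Topology.IsInducing.of_comp (hπ.comp continuous_subtype_val) hr
      (by rw [hcomp]; exact Topology.IsInducing.subtypeVal)
  refine ⟨⟨hind, fun c d hcd => Subtype.ext ?_⟩, ?_⟩
  · rw [← h c c.2, ← h d d.2]
    exact congrArg r hcd
  · have : Set.range (fun c : C => π c) = r ⁻¹' C ∩ {b | π (r b) = b} := by
      ext b
      constructor
      · rintro ⟨c, rfl⟩
        exact ⟨by simp [h c c.2], by simp [h c c.2]⟩
      · rintro ⟨hb, hb'⟩
        exact ⟨⟨r b, hb⟩, hb'⟩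
    rw [this]
    exact (hC.preimage hr).inter (isClosed_eq (hπ.comp hr) continuous_id)

theorem isClosed_fibreProduct {α β γ : Type*} [TopologicalSpace α] [TopologicalSpace β]
    [TopologicalSpace γ] [T2Space β] {f : Set (α × β)} {g : Set (β × γ)} (hf : IsClosed f)
    (hg : IsClosed g) : IsClosed (fibreProduct f g) := by
  have : fibreProduct f g = f ×ˢ g ∩ {p | p.1.2 = p.2.1} := by
    ext p
    exact and_assoc.symm
  rw [this]
  exact (hf.prod hg).inter (isClosed_eq (by fun_prop) (by fun_prop))

/-! ### Strong transversality -/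

section

open SympMan

variable {X Y Z Q M : SympMan.{u}}

theorem mem_tangentSet_middleDiagonal (x : X) (y : Y) (z : Z) (a : X.model) (b : Y.model)
    (c : Z.model) : (((a, b), (b, c)) : (X.model × Y.model) × (Y.model × Z.model)) ∈
      tangentSet ((X.I.prod Y.I).prod (Y.I.prod Z.I)) (middleDiagonal X Y Z)
        ((x, y), (y, z)) := by
  have h1 : HasMFDerivAt (X.I.prod (Y.I.prod Z.I)) X.I (fun p : X × Y × Z => p.1) (x, y, z)
      (ContinuousLinearMap.fst ℝ X.model (Y.model × Z.model)) := hasMFDerivAt_fst _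
  have h2 : HasMFDerivAt (X.I.prod (Y.I.prod Z.I)) (Y.I.prod Z.I) (fun p : X × Y × Z => p.2)
      (x, y, z) (ContinuousLinearMap.snd ℝ X.model (Y.model × Z.model)) := hasMFDerivAt_snd _
  have h3 : HasMFDerivAt (X.I.prod (Y.I.prod Z.I)) Y.I (fun p : X × Y × Z => p.2.1) (x, y, z)
      ((ContinuousLinearMap.fst ℝ Y.model Z.model).comp
        (ContinuousLinearMap.snd ℝ X.model (Y.model × Z.model))) :=
    HasMFDerivAt.comp (I'' := Y.I) (x, y, z) (hasMFDerivAt_fst (y, z)) h2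
  have h := (h1.prodMk h3).prodMk h2
  exact map_mem_tangentSet (T := middleDiagonal X Y Z) (v := (a, b, c)) h
    (Filter.Eventually.of_forall fun q _ => rfl) (mem_tangentSet_univ _ _)

/-- Modulo vectors with equal middle components, which are all tangent to `X × Δ_Y × Z`, the ambient
tangent space is that of `Y`, through the difference of the middle components. Transversality thus
follows once these differences exhaust it. -/
theorem isTransversal_of_exists_sub_eq {f : Set (X × Y)} {g : Set (Y × Z)}
    (h : ∀ x y z, (x, y) ∈ f → (y, z) ∈ g → ∀ u : Y.model,
      ∃ s : X.model × Y.model, s ∈ tangentSet (X.I.prod Y.I) f (x, y) ∧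
      ∃ t : Y.model × Z.model, t ∈ tangentSet (Y.I.prod Z.I) g (y, z) ∧ s.2 - t.1 = u) :
    IsTransversal f g := by
  rintro ⟨⟨x, y⟩, ⟨y', z⟩⟩ ⟨⟨hf, hg⟩, hy⟩ v
  obtain rfl : y = y' := hy
  obtain ⟨⟨a, b⟩, ⟨b', c⟩⟩ := v
  obtain ⟨⟨s₁, s₂⟩, hs, ⟨t₁, t₂⟩, ht, hst⟩ := h x y z hf hg (b - b')
  -- The pair `(s, t)` accounts for the discrepancy `b - b'`; what is left over has equal middle
  -- components.
  refine ⟨((s₁, s₂), (t₁, t₂)), mem_tangentSet_prod.2 ⟨hs, ht⟩,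
    ((a - s₁, b - s₂), (b - s₂, c - t₂)), mem_tangentSet_middleDiagonal x y z _ _ _, ?_⟩
  have h1 : b' = t₁ + (b - s₂) := by
    have : s₂ = b - b' + t₁ := sub_eq_iff_eq_add.1 hst
    rw [this]
    abel
  refine Prod.ext (Prod.ext ?_ ?_) (Prod.ext ?_ ?_)
  · exact add_sub_cancel s₁ a
  · exact add_sub_cancel s₂ b
  · exact h1.symm
  · exact add_sub_cancel t₂ c

theorem mem_tangentSet_fibreProduct {f : Set (X × Y)} {g : Set (Y × Z)}
    {p : (X × Y) × (Y × Z)} {v : (X.model × Y.model) × (Y.model × Z.model)}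
    (hv : v ∈ tangentSet ((X.I.prod Y.I).prod (Y.I.prod Z.I)) (fibreProduct f g) p) :
    v.1 ∈ tangentSet (X.I.prod Y.I) f p.1 ∧ v.2 ∈ tangentSet (Y.I.prod Z.I) g p.2 ∧
      v.1.2 = v.2.1 := by
  have hp := mem_of_mem_tangentSet hv
  obtain ⟨h1, h2⟩ := mem_tangentSet_prod.1
    (mem_tangentSet_of_eventually (T := f ×ˢ g)
      (Filter.Eventually.of_forall fun q hq => ⟨hq.1, hq.2.1⟩) hv)
  refine ⟨h1, h2, ?_⟩
  have k1 : HasMFDerivAt ((X.I.prod Y.I).prod (Y.I.prod Z.I)) Y.I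
      (fun p : (X × Y) × (Y × Z) => p.1.2) p ((ContinuousLinearMap.snd ℝ X.model Y.model).comp
        (ContinuousLinearMap.fst ℝ (X.model × Y.model) (Y.model × Z.model))) :=
    HasMFDerivAt.comp (I'' := Y.I) p (hasMFDerivAt_snd p.1) (hasMFDerivAt_fst p)
  have k2 : HasMFDerivAt ((X.I.prod Y.I).prod (Y.I.prod Z.I)) Y.I
      (fun p : (X × Y) × (Y × Z) => p.2.1) p ((ContinuousLinearMap.fst ℝ Y.model Z.model).comp
        (ContinuousLinearMap.snd ℝ (X.model × Y.model) (Y.model × Z.model))) :=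
    HasMFDerivAt.comp (I'' := Y.I) p (hasMFDerivAt_fst p.2) (hasMFDerivAt_snd p)
  have := map_mem_tangentSet (T := Set.diagonal Y) (k1.prodMk k2)
    (Filter.Eventually.of_forall fun q hq => hq.2.2) hv
  exact (mem_tangentSet_diagonal hp.2.2).1 this

/-- A transversal pair is strongly transversal if the middle point of a pair of composable elements
depends continuously on its end points, and the same holds for tangent vectors. -/
theorem isStronglyTransversal_of_section (f : CanRel X Y) (g : CanRel Y Z)
    (h : ∀ x y z, (x, y) ∈ f.graph → (y, z) ∈ g.graph → ∀ u : Y.model,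
      ∃ s : X.model × Y.model, s ∈ tangentSet (X.I.prod Y.I) f.graph (x, y) ∧
      ∃ t : Y.model × Z.model, t ∈ tangentSet (Y.I.prod Z.I) g.graph (y, z) ∧ s.2 - t.1 = u)
    (r : X × Z → Y) (hr : Continuous r)
    (hfg : ∀ x y z, (x, y) ∈ f.graph → (y, z) ∈ g.graph → y = r (x, z))
    (R : X.model → Z.model → Y.model)
    (hR : ∀ x y z, ∀ s : X.model × Y.model, ∀ t : Y.model × Z.model,
      s ∈ tangentSet (X.I.prod Y.I) f.graph (x, y) →
      t ∈ tangentSet (Y.I.prod Z.I) g.graph (y, z) → s.2 = t.1 → s.2 = R s.1 t.2) :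
    IsStronglyTransversal f.graph g.graph where
  transversal := isTransversal_of_exists_sub_eq h
  isClosedEmbedding := by
    refine isClosedEmbedding_restrict (isClosed_fibreProduct f.smooth.1 g.smooth.1)
      (π := fun p : (X × Y) × (Y × Z) => (p.1.1, p.2.2))
      (r := fun q => ((q.1, r q), (r q, q.2))) (by fun_prop) (by fun_prop) ?_
    rintro ⟨⟨x, y⟩, ⟨y', z⟩⟩ ⟨hf, hg, hy⟩
    obtain rfl : y = y' := hy
    simp only [← hfg x y z hf hg]
  immersion := by
    rintro ⟨⟨x, y⟩, ⟨y', z⟩⟩ ⟨-, -, hy⟩ v hv w hw hvw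
    obtain rfl : y = y' := hy
    obtain ⟨v1, v2, v3⟩ := mem_tangentSet_fibreProduct hv
    obtain ⟨w1, w2, w3⟩ := mem_tangentSet_fibreProduct hw
    obtain ⟨e1, e2⟩ : v.1.1 = w.1.1 ∧ v.2.2 = w.2.2 := Prod.mk_inj.1 hvw
    have e3 : v.1.2 = w.1.2 := by
      rw [hR x y z v.1 v.2 v1 v2 v3, hR x y z w.1 w.2 w1 w2 w3, e1, e2]
    exact Prod.ext (Prod.ext e1 e3) (Prod.ext (v3.symm.trans (e3.trans w3)) e2)

/-- With an empty fibre product the pointwise conditions are vacuous and the projection is the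
closed embedding of the empty space. An empty composition is therefore always a legal
identification. -/
theorem isStronglyTransversal_of_relComp_eq_empty {f : Set (X × Y)} {g : Set (Y × Z)}
    (h : relComp f g = ∅) : IsStronglyTransversal f g := by
  have hempty : ∀ p, p ∉ fibreProduct f g := by
    rintro ⟨⟨x, y⟩, ⟨y', z⟩⟩ ⟨hf, hg, hy⟩
    obtain rfl : y = y' := hy
    exact (h ▸ (⟨y, hf, hg⟩ : (x, z) ∈ relComp f g) : (x, z) ∈ (∅ : Set (X × Z)))
  have : IsEmpty (fibreProduct f g) := ⟨fun p => hempty p.1 p.2⟩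
  refine ⟨?_, ?_, fun p hp => (hempty p hp).elim⟩
  · rintro p ⟨⟨h1, h2⟩, h3⟩
    exact (hempty p ⟨h1, h2, h3⟩).elim
  · exact .of_continuous_injective_isClosedMap (continuous_of_const fun a => isEmptyElim a)
      (fun a => isEmptyElim a) fun s _ => by
        rw [Set.eq_empty_of_isEmpty s, Set.image_empty]
        exact isClosed_empty

/-- The composition of `f` with the reduction of `Q × Ȳ × Y` to `Q`. -/
noncomputable abbrev CanRel.contract (f : CanRel X Q) (Y : SympMan.{u}) :
    CanRel X (Q.prod (Y.neg.prod Y)) := f.extend (isLagSub_diagonal' Y)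

theorem CanRel.mem_tangentSet_contract {f : CanRel X Q}
    {p : X × Q.prod (Y.neg.prod Y)} {v : X.model × (Q.prod (Y.neg.prod Y)).model} :
    v ∈ tangentSet (X.I.prod (Q.prod (Y.neg.prod Y)).I) (f.contract Y).graph p ↔
      ((v.1, v.2.1) : X.model × Q.model) ∈ tangentSet (X.I.prod Q.I) f.graph (p.1, p.2.1) ∧
      p.2.2.1 = p.2.2.2 ∧ v.2.2.1 = v.2.2.2 := by
  refine CanRel.mem_tangentSet_extend.trans (and_congr_right fun _ => ?_)
  constructor
  · intro h
    have := mem_of_mem_tangentSet h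
    exact ⟨this, (mem_tangentSet_diagonal this).1 h⟩
  · rintro ⟨h1, h2⟩
    exact (mem_tangentSet_diagonal h1).2 h2

theorem CanRel.mem_tangentSet_id {x y : X} {v : X.model × X.model} :
    v ∈ tangentSet (X.I.prod X.I) (CanRel.id X).graph (x, y) ↔ x = y ∧ v.1 = v.2 := by
  constructor
  · intro h
    have := mem_of_mem_tangentSet h
    exact ⟨this, (mem_tangentSet_diagonal this).1 h⟩
  · rintro ⟨h1, h2⟩
    exact (mem_tangentSet_diagonal h1).2 h2

/-- The end points `(q, y)` force the middle point `(q, (y, y))`, and likewise for vectors. No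
condition on `B` is needed, because the two diagonals already span the middle tangent space. -/
theorem isStronglyTransversal_id_contract_juxtapose (B : CanRel Q Y) :
    IsStronglyTransversal ((CanRel.id Q).contract Y).graph (B.juxtapose (CanRel.id Y)).graph := by
  refine isStronglyTransversal_of_section _ _ ?_ (fun p => (p.1, (p.2, p.2)))
    (continuous_fst.prodMk (continuous_snd.prodMk continuous_snd)) ?_
    (fun a b => (a, (b, b))) ?_
  · rintro q ⟨q', ⟨y₁, y₂⟩⟩ y ⟨h1, h2⟩ ⟨h3, h4⟩ u
    let u₁ : Q.model := u.1
    let u₂ : Y.model := u.2.1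
    let u₃ : Y.model := u.2.2
    -- The contraction supplies `u₁` and `(u₂, u₂)`; the identity factor of the juxtaposition
    -- corrects the last entry by `u₂ - u₃`.
    refine ⟨(u₁, (u₁, (u₂, u₂))), CanRel.mem_tangentSet_contract.2
      ⟨CanRel.mem_tangentSet_id.2 ⟨h1, rfl⟩, h2, rfl⟩,
      ((0, (0, u₂ - u₃)), u₂ - u₃), CanRel.mem_tangentSet_juxtapose.2
      ⟨zero_mem_tangentSet h3, CanRel.mem_tangentSet_id.2 ⟨h4, rfl⟩⟩, ?_⟩
    exact Prod.ext (sub_zero u₁) (Prod.ext (sub_zero u₂) (sub_sub_cancel u₂ u₃))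
  · rintro q ⟨q', ⟨y₁, y₂⟩⟩ y ⟨h1, h2⟩ ⟨h3, h4⟩
    obtain rfl : q = q' := h1
    obtain rfl : y₁ = y₂ := h2
    obtain rfl : y₁ = y := h4
    rfl
  · rintro q ⟨q', ⟨y₁, y₂⟩⟩ y ⟨s₁, ⟨s₂, ⟨s₃, s₄⟩⟩⟩ ⟨⟨t₁, ⟨t₂, t₃⟩⟩, t₄⟩ hs ht hst
    obtain ⟨k1, -, k2⟩ := CanRel.mem_tangentSet_contract.1 hs
    obtain ⟨-, k3⟩ := CanRel.mem_tangentSet_juxtapose.1 ht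
    have k4 : s₁ = s₂ := (CanRel.mem_tangentSet_id.1 k1).2
    have k5 : t₃ = t₄ := (CanRel.mem_tangentSet_id.1 k3).2
    have k6 : s₃ = s₄ := k2
    have k7 : s₄ = t₃ := congrArg (fun p : Q.model × Y.model × Y.model => p.2.2) hst
    subst k4 k5 k6 k7
    rfl

/-- The target component of the contraction is free in all of `Q`, so its tangent vectors alone give
transversality, and the middle point can be read off from the source. -/
theorem isStronglyTransversal_contract (A : CanRel X Q) :
    IsStronglyTransversal A.graph ((CanRel.id Q).contract Y).graph := by
  refine isStronglyTransversal_of_section _ _ ?_ (fun p => p.2.1)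
    (continuous_fst.comp continuous_snd) ?_ (fun a b => b.1) ?_
  · rintro x q ⟨q', ⟨y₁, y₂⟩⟩ h0 ⟨h1, h2⟩ u
    refine ⟨0, zero_mem_tangentSet h0, (-u, (-u, (0, 0))), CanRel.mem_tangentSet_contract.2
      ⟨CanRel.mem_tangentSet_id.2 ⟨h1, rfl⟩, h2, rfl⟩, ?_⟩
    exact (zero_sub (-u)).trans (neg_neg u)
  · rintro x q ⟨q', ⟨y₁, y₂⟩⟩ - ⟨h1, -⟩
    exact h1
  · rintro x q ⟨q', ⟨y₁, y₂⟩⟩ ⟨s₁, s₂⟩ ⟨t₁, ⟨t₂, ⟨t₃, t₄⟩⟩⟩ - ht hst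
    exact hst.trans (CanRel.mem_tangentSet_id.1 (CanRel.mem_tangentSet_contract.1 ht).1).2

/-- Here the source component of `B × id` is free in all of `Y`, and the middle point is the last
component of the target. -/
theorem isStronglyTransversal_juxtapose (B : CanRel Q Y) (g : CanRel Y Z) :
    IsStronglyTransversal (B.juxtapose (CanRel.id Y)).graph g.graph := by
  refine isStronglyTransversal_of_section _ _ ?_ (fun p => p.1.2.2)
    (continuous_snd.comp (continuous_snd.comp continuous_fst)) ?_ (fun a b => a.2.2) ?_
  · rintro ⟨q, ⟨y₁, y₂⟩⟩ y z ⟨h1, h2⟩ h0 u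
    refine ⟨((0, (0, u)), u), CanRel.mem_tangentSet_juxtapose.2
      ⟨zero_mem_tangentSet h1, CanRel.mem_tangentSet_id.2 ⟨h2, rfl⟩⟩, 0,
      zero_mem_tangentSet h0, sub_zero u⟩
  · rintro ⟨q, ⟨y₁, y₂⟩⟩ y z ⟨h1, h2⟩ -
    exact h2.symm
  · rintro ⟨q, ⟨y₁, y₂⟩⟩ y z ⟨⟨s₁, ⟨s₂, s₃⟩⟩, s₄⟩ t hs - -
    exact (CanRel.mem_tangentSet_id.1 (CanRel.mem_tangentSet_juxtapose.1 hs).2).2.symm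

end

/-- Up to reordering coordinates, the projection is the product of a proper map with the inclusion
of a closed set. -/
theorem isProperMap_extend {α β γ : Type*} [TopologicalSpace α] [TopologicalSpace β]
    [TopologicalSpace γ] {F : Set (α × β)} {L : Set γ} (hL : IsClosed L)
    (hF : IsProperMap (fun p : F => p.1.2)) :
    IsProperMap (fun p : {p : α × β × γ | (p.1, p.2.1) ∈ F ∧ p.2.2 ∈ L} => p.1.2) := by
  let e : {p : α × β × γ | (p.1, p.2.1) ∈ F ∧ p.2.2 ∈ L} ≃ₜ F × L :=
    { toFun := fun p => (⟨(p.1.1, p.1.2.1), p.2.1⟩, ⟨p.1.2.2, p.2.2⟩)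
      invFun := fun p => ⟨(p.1.1.1, (p.1.1.2, p.2.1)), p.1.2, p.2.2⟩
      left_inv := fun _ => rfl
      right_inv := fun _ => rfl
      continuous_toFun := by fun_prop
      continuous_invFun := by fun_prop }
  exact (hF.prodMap hL.isClosedEmbedding_subtypeVal.isProperMap).comp e.isProperMap

/-! ### Reductions and coreductions -/

section

open SympMan

variable {X Y Z Q M : SympMan.{u}}

theorem isReduction_id (X : SympMan.{u}) : IsReduction (CanRel.id X).graph where
  surjective x := ⟨x, rfl⟩
  coinjective := by
    rintro y x x' (rfl : x = y) (rfl : x' = x)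
    rfl
  surjective_differential x := ⟨x, CanRel.mem_tangentSet_id.2 ⟨rfl, rfl⟩⟩
  coinjective_differential := by
    rintro ⟨y, w⟩ ⟨x, v⟩ ⟨x', v'⟩ h h'
    obtain ⟨h1, h2⟩ := CanRel.mem_tangentSet_id.1 h
    obtain ⟨h3, h4⟩ := CanRel.mem_tangentSet_id.1 h'
    obtain rfl : x = y := h1
    obtain rfl : x' = x := h3
    exact congrArg _ (h2.trans h4.symm)
  proper := (isClosedEmbedding_restrict (CanRel.id X).smooth.1 (π := Prod.snd)
    (r := fun x => (x, x)) continuous_snd (continuous_id.prodMk continuous_id)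
    (by rintro ⟨x, y⟩ (rfl : x = y); rfl)).isProperMap

/-- A point of `L`, with the zero vector at it, completes any preimage under `f`; this is where `L`
must be nonempty. -/
theorem IsReduction.extend {f : CanRel X Q} (hf : IsReduction f.graph) {L : Set M}
    (hL : IsLagSub M L) (hne : L.Nonempty) : IsReduction (f.extend hL).graph where
  surjective x := by
    obtain ⟨q, hq⟩ := hf.surjective x
    obtain ⟨m, hm⟩ := hne
    exact ⟨(q, m), hq, hm⟩
  coinjective := fun y x x' h h' => hf.coinjective y.1 x x' h.1 h'.1
  surjective_differential x := by
    obtain ⟨q, hq⟩ := hf.surjective_differential x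
    obtain ⟨m, hm⟩ := hne
    exact ⟨⟨(q.1, m), (q.2, (0 : M.model))⟩,
      CanRel.mem_tangentSet_extend.2 ⟨hq, zero_mem_tangentSet hm⟩⟩
  coinjective_differential := fun y x x' h h' =>
    hf.coinjective_differential ⟨y.1.1, (y.2 : (Q.prod M).model).1⟩ x x'
      (CanRel.mem_tangentSet_extend.1 h).1 (CanRel.mem_tangentSet_extend.1 h').1
  proper := isProperMap_extend hL.closed hf.proper

theorem CanRel.mem_tangentSet_relTranspose {f : CanRel X Y} {p : Y × X} {v : Y.model × X.model} :
    v ∈ tangentSet (Y.I.prod X.I) (relTranspose f.graph) p ↔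
      ((v.2, v.1) : X.model × Y.model) ∈ tangentSet (X.I.prod Y.I) f.graph (p.2, p.1) :=
  (swapIso X Y).mem_tangentSet (S := f.graph) (p := p) (v := v)

/-- The point of `Y` related to `(q, (y', y))` is `y`, so the transpose is single valued whatever
`B` is. One fixed point of `B`, with the zero vector at it, makes it surjective together with its
differential. -/
theorem isCoreduction_juxtapose_id {B : CanRel Q Y} (hB : B.graph.Nonempty) :
    IsCoreduction (B.juxtapose (CanRel.id Y)).graph where
  surjective y := by
    obtain ⟨⟨q, y'⟩, h⟩ := hB
    exact ⟨(q, (y', y)), h, rfl⟩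
  coinjective := by
    rintro p y y' ⟨-, h⟩ ⟨-, h'⟩
    exact (Eq.symm h : y = p.2.2).trans h'
  surjective_differential y := by
    obtain ⟨⟨q, y'⟩, h⟩ := hB
    exact ⟨⟨(q, (y', y.1)), ((0 : Q.model), ((0 : Y.model), y.2))⟩,
      CanRel.mem_tangentSet_relTranspose.2 (CanRel.mem_tangentSet_juxtapose.2
        ⟨zero_mem_tangentSet h, CanRel.mem_tangentSet_id.2 ⟨rfl, rfl⟩⟩)⟩
  coinjective_differential := by
    rintro ⟨p, w⟩ ⟨y, v⟩ ⟨y', v'⟩ h h'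
    obtain ⟨h1, h2⟩ := CanRel.mem_tangentSet_id.1
      (CanRel.mem_tangentSet_juxtapose.1 (CanRel.mem_tangentSet_relTranspose.1 h)).2
    obtain ⟨h3, h4⟩ := CanRel.mem_tangentSet_id.1
      (CanRel.mem_tangentSet_juxtapose.1 (CanRel.mem_tangentSet_relTranspose.1 h')).2
    obtain rfl : y = y' := h1.symm.trans h3
    exact congrArg _ (h2.symm.trans h4)
  proper := (isClosedEmbedding_restrict (β := Q.prod (Y.neg.prod Y))
    (B.juxtapose (CanRel.id Y)).transpose.smooth.1 (π := Prod.snd)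
    (r := fun p => (p.2.2, p)) continuous_snd
    ((continuous_snd.comp continuous_snd).prodMk continuous_id)
    (by rintro ⟨y, ⟨q, ⟨y', y''⟩⟩⟩ ⟨-, h⟩; exact Prod.ext h rfl)).isProperMap

theorem isReduction_of_isEmpty [IsEmpty X] (f : Set (X × Y)) : IsReduction f where
  surjective x := isEmptyElim x
  coinjective _ x := isEmptyElim x
  surjective_differential x := isEmptyElim x.1
  coinjective_differential _ x := isEmptyElim x.1
  proper := by
    have : IsEmpty f := ⟨fun p => isEmptyElim p.1.1⟩
    exact (Topology.IsClosedEmbedding.of_continuous_injective_isClosedMap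
      (continuous_of_const fun a => isEmptyElim a) (fun a => isEmptyElim a) fun s _ => by
        rw [Set.eq_empty_of_isEmpty s, Set.image_empty]
        exact isClosed_empty).isProperMap

/-- The empty canonical relation. -/
def CanRel.empty (X Y : SympMan.{u}) : CanRel X Y where
  graph := ∅
  smooth := ⟨isClosed_empty, fun _ h => h.elim⟩
  lagrangian := fun _ h => h.elim

/-! ### Computations with classes in the Wehrheim–Woodward category -/

theorem CanRel.ext_graph {f g : CanRel X Y} (h : f.graph = g.graph) : f = g := by
  cases f
  cases g
  cases h
  rfl

/-- The class of a single canonical relation. -/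
abbrev CanRel.cls (f : CanRel X Y) : WW.of X ⟶ WW.of Y := WW.cls (single f)

theorem cls_comp (p : Quiver.Path X Y) (q : Quiver.Path Y Z) :
    WW.cls (p.comp q) = WW.cls p ≫ WW.cls q :=
  (Quotient.functor Elementary.{u}).map_comp (X := X) (Y := Y) (Z := Z) p q

theorem cls_id (X : SympMan.{u}) : (CanRel.id X).cls = 𝟙 (WW.of X) :=
  (CategoryTheory.Quotient.sound Elementary.{u} (Elementary.identity (CanRel.id X) rfl)).trans
    ((Quotient.functor Elementary.{u}).map_id (X := X))

theorem cls_comp_cls {f : CanRel X Y} {g : CanRel Y Z} (h : CanRel X Z)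
    (hfg : IsStronglyTransversal f.graph g.graph) (hh : h.graph = relComp f.graph g.graph) :
    f.cls ≫ g.cls = h.cls :=
  (cls_comp _ _).symm.trans
    (CategoryTheory.Quotient.sound Elementary.{u} (Elementary.comp f g h hfg hh))

theorem cls_comp_eq_empty {f : CanRel X Y} {g : CanRel Y Z} (h : relComp f.graph g.graph = ∅) :
    f.cls ≫ g.cls = (CanRel.empty X Z).cls :=
  cls_comp_cls _ (isStronglyTransversal_of_relComp_eq_empty h) h.symm

theorem relComp_empty {α β γ : Type*} (f : Set (α × β)) : relComp f (∅ : Set (β × γ)) = ∅ :=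
  Set.eq_empty_of_forall_notMem fun _ ⟨_, _, h⟩ => h

theorem empty_relComp {α β γ : Type*} (g : Set (β × γ)) : relComp (∅ : Set (α × β)) g = ∅ :=
  Set.eq_empty_of_forall_notMem fun _ ⟨_, h, _⟩ => h

theorem cls_comp_empty (f : CanRel X Y) (Z : SympMan.{u}) :
    f.cls ≫ (CanRel.empty Y Z).cls = (CanRel.empty X Z).cls :=
  cls_comp_eq_empty (relComp_empty _)

theorem empty_comp_cls (X : SympMan.{u}) (g : CanRel Y Z) :
    (CanRel.empty X Y).cls ≫ g.cls = (CanRel.empty X Z).cls :=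
  cls_comp_eq_empty (empty_relComp _)

/-- A class which is represented by a reduction followed by a nonempty canonical relation. -/
def HasReductionForm (φ : WW.of X ⟶ WW.of Y) : Prop :=
  ∃ (Q : SympMan.{u}) (A : CanRel X Q) (B : CanRel Q Y), IsReduction A.graph ∧ B.graph.Nonempty ∧
    φ = A.cls ≫ B.cls

/-- The heart of the proof: both factors on the left are split off through the identity versions,
and the two inner pieces compose to `B`. Nothing is assumed about `B` and `g`. -/
theorem cls_contract_comp_juxtapose (A : CanRel X Q) (B : CanRel Q Y) (g : CanRel Y Z) :
    (A.contract Y).cls ≫ (B.juxtapose g).cls = A.cls ≫ B.cls ≫ g.cls := by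
  have h1 : A.cls ≫ ((CanRel.id Q).contract Y).cls = (A.contract Y).cls := by
    refine cls_comp_cls _ (isStronglyTransversal_contract A) (Set.ext ?_)
    rintro ⟨x, ⟨q, ⟨y₁, y₂⟩⟩⟩
    constructor
    · rintro ⟨h1, h2⟩
      exact ⟨q, h1, rfl, h2⟩
    · rintro ⟨q', h1, h2, h3⟩
      obtain rfl : q' = q := h2
      exact ⟨h1, h3⟩
  have h2 : ((CanRel.id Q).contract Y).cls ≫ (B.juxtapose (CanRel.id Y)).cls = B.cls := by
    refine cls_comp_cls _ (isStronglyTransversal_id_contract_juxtapose B) (Set.ext ?_)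
    rintro ⟨q, y⟩
    constructor
    · intro h
      exact ⟨(q, (y, y)), ⟨rfl, rfl⟩, h, rfl⟩
    · rintro ⟨⟨q', ⟨y₁, y₂⟩⟩, ⟨h1, h2⟩, h3, h4⟩
      obtain rfl : q = q' := h1
      obtain rfl : y₁ = y₂ := h2
      obtain rfl : y₁ = y := h4
      exact h3
  have h3 : (B.juxtapose (CanRel.id Y)).cls ≫ g.cls = (B.juxtapose g).cls := by
    refine cls_comp_cls _ (isStronglyTransversal_juxtapose B g) (Set.ext ?_)
    rintro ⟨⟨q, ⟨y₁, y₂⟩⟩, z⟩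
    constructor
    · rintro ⟨h1, h2⟩
      exact ⟨y₂, ⟨h1, rfl⟩, h2⟩
    · rintro ⟨y, ⟨h1, h2⟩, h3⟩
      obtain rfl : y₂ = y := h2
      exact ⟨h1, h3⟩
  rw [← h1, ← h3, Category.assoc, ← Category.assoc _ _ g.cls, h2]

/-- A point of `B` provides a point of `Y`, so that the diagonal is nonempty and the contraction
stays a reduction; a point of `g` keeps the new second entry nonempty. -/
theorem HasReductionForm.comp_cls {φ : WW.of X ⟶ WW.of Y} (h : HasReductionForm φ)
    {g : CanRel Y Z} (hg : g.graph.Nonempty) : HasReductionForm (φ ≫ g.cls) := by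
  obtain ⟨Q, A, B, hA, ⟨⟨q, y⟩, hB⟩, rfl⟩ := h
  obtain ⟨⟨y', z⟩, hg⟩ := hg
  refine ⟨_, A.contract Y, B.juxtapose g, hA.extend _ ⟨(y, y), rfl⟩,
    ⟨((q, (y, y')), z), hB, hg⟩, ?_⟩
  rw [cls_contract_comp_juxtapose, Category.assoc]

theorem hasReductionForm_id [Nonempty X] : HasReductionForm (𝟙 (WW.of X)) := by
  obtain ⟨x⟩ := ‹Nonempty X›
  exact ⟨X, CanRel.id X, CanRel.id X, isReduction_id X, ⟨(x, x), rfl⟩, by simp [cls_id]⟩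

/-- Between nonempty symplectic manifolds the class of the empty relation is a composition of
nonempty canonical relations. -/
theorem exists_nonempty_comp_eq_empty (x : X) (y : Y) :
    ∃ (Q : SympMan.{u}) (f : CanRel X Q) (g : CanRel Q Y), f.graph.Nonempty ∧ g.graph.Nonempty ∧
      f.cls ≫ g.cls = (CanRel.empty X Y).cls := by
  obtain ⟨V, hV⟩ := X.exists_lagrangian_submodule x
  obtain ⟨W, hW⟩ := Y.exists_lagrangian_submodule y
  refine ⟨(X.sumTangent x).prod (Y.sumTangent y),
    (isLagSub_inl X x).toCanRel.extend (isLagSub_inr Y y hW),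
    CanRel.coextend (isLagSub_inr X x hV) (isLagSub_inl Y y).toCanRel.transpose,
    ⟨(x, (X.inl x x, Y.inr y 0)), rfl, ⟨0, W.zero_mem, rfl⟩⟩,
    ⟨((X.inr x 0, Y.inl y y), y), ⟨0, V.zero_mem, rfl⟩, rfl⟩, cls_comp_eq_empty ?_⟩
  refine Set.eq_empty_of_forall_notMem ?_
  rintro ⟨x', y'⟩ ⟨⟨p, q⟩, ⟨h1, -⟩, ⟨v, -, h2⟩, -⟩
  -- The first relation puts the first coordinate of the middle point in `X`, the second puts it in
  -- the tangent space.
  have h3 : (Sum.inr v : X ⊕ X.model) = Sum.inl x' := h2.trans h1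
  cases h3

theorem hasReductionForm_empty [hX : Nonempty X] [hY : Nonempty Y] :
    HasReductionForm (CanRel.empty X Y).cls := by
  obtain ⟨x⟩ := hX
  obtain ⟨y⟩ := hY
  obtain ⟨Q, f, g, hf, hg, h⟩ := exists_nonempty_comp_eq_empty x y
  have : Nonempty X := ⟨x⟩
  have := (hasReductionForm_id.comp_cls hf).comp_cls hg
  rwa [Category.id_comp, h] at this

/-- Induction on the sequence: nonempty entries are absorbed, while a single empty entry collapses
the class to that of the empty relation. On an empty manifold the identity relation is itself empty.
-/
theorem hasReductionForm_or_eq_empty (f : Quiver.Path X Y) :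
    HasReductionForm (WW.cls f) ∨ WW.cls f = (CanRel.empty X Y).cls := by
  induction f with
  | nil =>
    have hnil : WW.cls (Quiver.Path.nil : Quiver.Path X X) = 𝟙 (WW.of X) :=
      (Quotient.functor Elementary.{u}).map_id (X := X)
    rw [hnil]
    rcases isEmpty_or_nonempty X with hX | hX
    · right
      rw [← cls_id]
      congr 1
      refine CanRel.ext_graph ?_
      exact Set.eq_empty_of_forall_notMem fun p => isEmptyElim p.1
    · exact .inl hasReductionForm_id
  | cons p g ih =>
    have hcons : WW.cls (p.cons g) = WW.cls p ≫ CanRel.cls g := cls_comp p (single g)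
    rw [hcons]
    rcases Set.eq_empty_or_nonempty (CanRel.graph g) with hg | hg
    · obtain rfl : g = CanRel.empty _ _ := CanRel.ext_graph hg
      right
      rcases ih with ⟨Q, A, B, -, -, h⟩ | h
      · rw [h, Category.assoc, cls_comp_empty, cls_comp_empty]
      · rw [h, cls_comp_empty]
    · rcases ih with h | h
      · exact .inl (h.comp_cls hg)
      · right
        rw [h, empty_comp_cls]

/-- Absorbing one more entry, the identity of `Y`, does not change the class but replaces `B` by `B
× id`, a coreduction. -/
theorem HasReductionForm.exists_reduction_coreduction {φ : WW.of X ⟶ WW.of Y}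
    (h : HasReductionForm φ) : ∃ (Q : SympMan.{u}) (A : CanRel X Q) (B : CanRel Q Y),
      IsReduction A.graph ∧ IsCoreduction B.graph ∧ φ = A.cls ≫ B.cls := by
  obtain ⟨Q, A, B, hA, ⟨⟨q, y⟩, hB⟩, rfl⟩ := h
  refine ⟨_, A.contract Y, B.juxtapose (CanRel.id Y), hA.extend _ ⟨(y, y), rfl⟩,
    isCoreduction_juxtapose_id ⟨(q, y), hB⟩, ?_⟩
  rw [cls_contract_comp_juxtapose, cls_id, Category.comp_id]

/-- A relation with empty target is trivially a reduction, and one with empty source a coreduction.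
If neither end is empty, the class also comes from nonempty relations and the general argument
applies. -/
theorem exists_reduction_coreduction_empty (X Y : SympMan.{u}) :
    ∃ (Q : SympMan.{u}) (A : CanRel X Q) (B : CanRel Q Y),
      IsReduction A.graph ∧ IsCoreduction B.graph ∧ (CanRel.empty X Y).cls = A.cls ≫ B.cls := by
  rcases isEmpty_or_nonempty X with hX | hX
  · refine ⟨Y, CanRel.empty X Y, CanRel.id Y, isReduction_of_isEmpty _, ?_,
      by rw [cls_id, Category.comp_id]⟩
    have : relTranspose (CanRel.id Y).graph = (CanRel.id Y).graph := Set.ext fun p => eq_comm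
    rw [IsCoreduction, this]
    exact isReduction_id Y
  · rcases isEmpty_or_nonempty Y with hY | hY
    · exact ⟨X, CanRel.id X, CanRel.empty X Y, isReduction_id X, isReduction_of_isEmpty _,
        by rw [cls_id, Category.id_comp]⟩
    · exact hasReductionForm_empty.exists_reduction_coreduction

theorem exists_reduction_coreduction (f : Quiver.Path X Y) :
    ∃ (Q : SympMan.{u}) (A : CanRel X Q) (B : CanRel Q Y),
      IsReduction A.graph ∧ IsCoreduction B.graph ∧
        WW.cls f = WW.cls ((single A).comp (single B)) := by
  simp only [cls_comp]
  rcases hasReductionForm_or_eq_empty f with h | h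
  · exact h.exists_reduction_coreduction
  · rw [h]
    exact exists_reduction_coreduction_empty X Y

end

end WehrheimWoodward

theorem mainTheorem1 (X Y : WehrheimWoodward.SympMan.{u}) :
    (∀ f : Quiver.Path X Y,
      ∃ (Q : WehrheimWoodward.SympMan.{u}) (A : WehrheimWoodward.CanRel X Q)
        (B : WehrheimWoodward.CanRel Q Y),
        WehrheimWoodward.IsReduction A.graph ∧ WehrheimWoodward.IsCoreduction B.graph ∧
        WehrheimWoodward.WW.cls f = WehrheimWoodward.WW.cls
          ((WehrheimWoodward.single A).comp (WehrheimWoodward.single B))) ∧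
    (∀ φ : WehrheimWoodward.WW.of X ⟶ WehrheimWoodward.WW.of Y,
      ∃ (Q : WehrheimWoodward.SympMan.{u}) (A : WehrheimWoodward.CanRel X Q)
        (B : WehrheimWoodward.CanRel Q Y),
        WehrheimWoodward.IsReduction A.graph ∧ WehrheimWoodward.IsCoreduction B.graph ∧
        φ = WehrheimWoodward.WW.cls
          ((WehrheimWoodward.single A).comp (WehrheimWoodward.single B))) := by
  refine ⟨WehrheimWoodward.exists_reduction_coreduction, fun φ => ?_⟩
  obtain ⟨f, rfl⟩ := (Quotient.functor WehrheimWoodward.Elementary.{u}).map_surjective φ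
  exact WehrheimWoodward.exists_reduction_coreduction f
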